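/- Let $M$ be a smooth ($C^\infty$, Hausdorff) real manifold of dimension $n$ (without boundary), and let $p\colon T^*M\to M$ be its cotangent bundle. Let $\mathcal V(M)=\ker dp\subset T(T^*M)$ be the bundle of vectors tangent to the fibres, and let $\mathcal A=\Gamma(\mathcal V(M))$ be the space of vertical vector fields on $T^*M$, with the product $ss'=D_s s'$, where $D$ is the canonical flat connection of the vector spaces $T_q^*M$. Let $\mathcal G=\mathcal A\oplus C^\infty(T^*M)$ be the Koszul–Vinberg algebra with product $$(s,f)(s',f')=(ss',\,ff'+s\cdot f').$$ Put $J(\mathcal G)=\{c\in\mathcal G : a(bc)-(ab)c=0 \text{ for all } a,b\in\mathcal G\}$ and consider the complex $$J(\mathcal G)\xrightarrow{\ \delta_0\ }\operatorname{Hom}_{\mathbb R}(\mathcal G,\mathcal G)\xrightarrow{\ \delta_1\ }\operatorname{Hom}_{\mathbb R}(\mathcal G\otimes\mathcal G,\mathcal G),$$ $$\delta_0(w)(a)=-aw+wa,\qquad (\delta_1\theta)(a,b)=-\bigl(a\,\theta(b)-\theta(ab)+\theta(a)\,b\bigr),$$ and let $H_1(\mathcal V(M))=\ker\delta_1/\operatorname{im}\delta_0$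 be the first homology of the cotangent Koszul–Vinberg algebroid with coefficients in itself. For a vector field $Z$ on $M$ let $\ell_Z(\xi)=\xi(Z_{p(\xi)})$ be the corresponding fibrewise linear function on $T^*M$. Then: 1. Every smooth vector field $X$ on $M$ has a unique cotangent lift, that is, there is a unique smooth vector field $\tilde X$ on $T^*M$ that projects to $X$ and satisfies $\tilde X\,\ell_Z=\ell_{[X,Z]}$ for all $Z\in\Gamma(TM)$ (equivalently, $\tilde X$ generates the local flow on $T^*M$ induced by the local flow of $X$). 2. For every $X\in\Gamma(TM)$ the Lie derivative $L_{\tilde X}\colon\mathcal G\to\mathcal G$, $(s,f)\mapsto([\tilde X,s],\tilde X f)$, is well defined and is a 1-cycle ($\delta_1L_{\tilde X}=0$), and the canonical map $$\Gamma(TM)\longrightarrow H_1(\mathcal V(M)),\qquad X\longmapsto[L_{\tilde X}],$$ is linear and injective. 3. If $M$ is nonempty and $n\ge 1$, then the real vector space $H_1(\mathcal V(M))$ is infinite-dimensional. -/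

import Mathlib

open scoped Manifold ContDiff Bundle

namespace KV

/-- The fibre model `(ℝⁿ)*` of the cotangent bundle of an `n`-dimensional manifold. -/
abbrev CoModel (n : ℕ) := EuclideanSpace ℝ (Fin n) →L[ℝ] ℝ

/-- The model with corners of the `2n`-dimensional manifold `T*M`. -/
noncomputable abbrev coI (n : ℕ) := (𝓡 n).prod 𝓘(ℝ, CoModel n)

section Cotangent

variable (n : ℕ) (M : Type*) [TopologicalSpace M] [ChartedSpace (EuclideanSpace ℝ (Fin n)) M]
  [IsManifold (𝓡 n) ∞ M]

/-- The cotangent space of `M` at `q`. -/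
abbrev CotangentSpace (q : M) := TangentSpace (𝓡 n) q →L[ℝ] Bundle.Trivial M ℝ q

/-- The total space `T*M` of the cotangent bundle, with its manifold structure from Mathlib. -/
abbrev Cotangent := Bundle.TotalSpace (CoModel n) (CotangentSpace n M)

noncomputable instance : TopologicalSpace (Cotangent n M) := inferInstance
noncomputable instance : ChartedSpace (ModelProd (EuclideanSpace ℝ (Fin n)) (CoModel n))
  (Cotangent n M) := inferInstance
noncomputable instance : IsManifold (coI n) ∞ (Cotangent n M) := inferInstance
noncomputable instance : IsManifold (coI n) 1 (Cotangent n M) := inferInstance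
noncomputable instance : TopologicalSpace (TangentBundle (coI n) (Cotangent n M)) := inferInstance
noncomputable instance : NormedAddCommGroup (CoModel n) := inferInstance
noncomputable instance : NormedSpace ℝ (CoModel n) := inferInstance

/-- `Γ(TM)`: smooth vector fields on `M`. -/
abbrev VectorFields := Cₛ^∞⟮𝓡 n; EuclideanSpace ℝ (Fin n), (TangentSpace (𝓡 n) : M → Type _)⟯

/-- Smooth vector fields on `T*M`. -/
abbrev CoVectorFields :=
  Cₛ^∞⟮coI n; EuclideanSpace ℝ (Fin n) × CoModel n,
    (TangentSpace (coI n) : Cotangent n M → Type _)⟯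

/-- Smooth real functions on `T*M`. -/
abbrev CoFunctions := C^∞⟮coI n, Cotangent n M; 𝓘(ℝ, ℝ), ℝ⟯

end Cotangent

section Directional

variable {EN HN N V : Type*} [NormedAddCommGroup EN] [NormedSpace ℝ EN] [TopologicalSpace HN]
  {J : ModelWithCorners ℝ EN HN} [TopologicalSpace N] [ChartedSpace HN N] [IsManifold J ∞ N]
  [NormedAddCommGroup V] [NormedSpace ℝ V]

theorem contMDiffAt_dirDeriv (Y : Cₛ^∞⟮J; EN, (TangentSpace J : N → Type _)⟯) {r : N → V} {x : N}
    (hr : ContMDiffAt J 𝓘(ℝ, V) ∞ r x) :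
    ContMDiffAt J 𝓘(ℝ, V) ∞ (fun y => (mfderiv J 𝓘(ℝ, V) r y (Y y) : V)) x := by
  have h1 := hr.mfderiv_const (m := ∞) (by simp)
  have h2 := Y.contMDiff x
  have h3 := ContMDiffAt.clm_apply_of_inCoordinates (b₁ := id) (b₂ := r)
    (ϕ := fun y => mfderiv J 𝓘(ℝ, V) r y) (v := fun y => Y y) h1 h2 hr
  have h4 := (Bundle.contMDiffAt_totalSpace.1 h3).2
  simpa using h4

end Directional

section Vertical

variable {n : ℕ} {M : Type*} [TopologicalSpace M] [ChartedSpace (EuclideanSpace ℝ (Fin n)) M]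
  [IsManifold (𝓡 n) ∞ M]

/-- The inclusion of the fibre `T*_q M` into `T*M`. -/
def fiberIncl (q : M) (p : CoModel n) : Cotangent n M := ⟨q, p⟩

/-- A covector, as an element of the fibre model. -/
def fibPt (ξ : Cotangent n M) : CoModel n := ξ.snd

/-- The vertical lift `T*_q M → T_ξ(T*M)`, `η ↦ d/dt (ξ + tη)|_{t=0}`, where `q` is the base point
of `ξ`. -/
noncomputable def vlift (ξ : Cotangent n M) : CoModel n →L[ℝ] TangentSpace (coI n) ξ :=
  mfderiv 𝓘(ℝ, CoModel n) (coI n) (fiberIncl ξ.proj) (fibPt ξ)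

/-- Local fibre coordinates on `T*M` around the fibre over `q`. -/
noncomputable def fibCoord (q : M) (ξ : Cotangent n M) : CoModel n :=
  (trivializationAt (CoModel n) (CotangentSpace n M) q ξ).2

theorem fiber_baseSet_mem (q : M) :
    ∀ᶠ x in nhds q, x ∈ (trivializationAt (CoModel n) (CotangentSpace n M) q).baseSet :=
  (trivializationAt (CoModel n) (CotangentSpace n M) q).open_baseSet.mem_nhds
    (FiberBundle.mem_baseSet_trivializationAt' q)

/-- Linear change of coordinates on the fibre over `q'`. -/
noncomputable def fibEquiv (q q' : M)
    (h : q' ∈ (trivializationAt (CoModel n) (CotangentSpace n M) q).baseSet) :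
    CoModel n ≃L[ℝ] CoModel n := by
  exact (trivializationAt (CoModel n) (CotangentSpace n M) q).continuousLinearEquivAt ℝ q' h

theorem fibCoord_incl {q q' : M}
    (h : q' ∈ (trivializationAt (CoModel n) (CotangentSpace n M) q).baseSet) (p : CoModel n) :
    fibCoord q (fiberIncl q' p) = fibEquiv q q' h p := by
  rfl

theorem contMDiff_fiberIncl (q : M) :
    ContMDiff 𝓘(ℝ, CoModel n) (coI n) ∞ (fiberIncl (n := n) q) := by
  intro p
  rw [Bundle.contMDiffAt_totalSpace]
  refine ⟨contMDiffAt_const, ?_⟩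
  exact (fibEquiv (n := n) q q (FiberBundle.mem_baseSet_trivializationAt' q) :
    CoModel n →L[ℝ] CoModel n).contMDiff.contMDiffAt

theorem contMDiffAt_fibCoord {q : M} {ξ : Cotangent n M}
    (h : ξ.proj ∈ (trivializationAt (CoModel n) (CotangentSpace n M) q).baseSet) :
    ContMDiffAt (coI n) 𝓘(ℝ, CoModel n) ∞ (fibCoord q) ξ := by
  have h1 := (trivializationAt (CoModel n) (CotangentSpace n M) q).contMDiffOn (n := ∞)
    (IB := 𝓡 n)
  have h2 := h1.contMDiffAt ((trivializationAt (CoModel n) (CotangentSpace n M)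
    q).open_source.mem_nhds ((Bundle.Trivialization.mem_source _).2 h))
  exact h2.snd

/-- Chain rule along the fibres. -/
theorem mfderiv_vlift {V : Type*} [NormedAddCommGroup V] [NormedSpace ℝ V]
    {r : Cotangent n M → V} {ξ : Cotangent n M} (hr : ContMDiffAt (coI n) 𝓘(ℝ, V) ∞ r ξ)
    (η : CoModel n) :
    (mfderiv (coI n) 𝓘(ℝ, V) r ξ (vlift ξ η) : V) =
      fderiv ℝ (fun p : CoModel n => r (fiberIncl ξ.proj p)) (fibPt ξ) η := by
  have h := mfderiv_comp (I := 𝓘(ℝ, CoModel n)) (I' := coI n) (I'' := 𝓘(ℝ, V))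
    (fibPt ξ) (g := r) (f := fiberIncl (n := n) ξ.proj)
    (hr.mdifferentiableAt (by simp))
    ((contMDiff_fiberIncl ξ.proj).mdifferentiableAt (by simp))
  exact (DFunLike.congr_fun (mfderiv_eq_fderiv.symm.trans h) η).symm

theorem mfderiv_proj_vlift (ξ : Cotangent n M) (η : CoModel n) :
    mfderiv (coI n) (𝓡 n) (Bundle.TotalSpace.proj : Cotangent n M → M) ξ (vlift ξ η) = 0 := by
  have h := mfderiv_comp (I := 𝓘(ℝ, CoModel n)) (I' := coI n) (I'' := 𝓡 n)
    (fibPt ξ) (g := (Bundle.TotalSpace.proj : Cotangent n M → M))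
    (f := fiberIncl (n := n) ξ.proj)
    ((Bundle.contMDiff_proj (n := ∞) (CotangentSpace n M)).mdifferentiableAt (by simp))
    ((contMDiff_fiberIncl ξ.proj).mdifferentiableAt (by simp))
  have h2 := mfderiv_const (I := 𝓘(ℝ, CoModel n)) (I' := 𝓡 n) (c := ξ.proj) (x := fibPt ξ)
  exact (DFunLike.congr_fun (h2.symm.trans h) η).symm

theorem mfderiv_fibCoord_vlift {q : M} {ξ : Cotangent n M}
    (h : ξ.proj ∈ (trivializationAt (CoModel n) (CotangentSpace n M) q).baseSet) (η : CoModel n) :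
    mfderiv (coI n) 𝓘(ℝ, CoModel n) (fibCoord q) ξ (vlift ξ η) =
      fibCoord q (fiberIncl ξ.proj η) := by
  have h0 := mfderiv_vlift (contMDiffAt_fibCoord h) η
  rw [fibCoord_incl h]
  refine h0.trans ?_
  exact DFunLike.congr_fun (fibEquiv q ξ.proj h : CoModel n →L[ℝ] CoModel n).hasFDerivAt.fderiv η

/-- A chart of `T*M`. -/
theorem mfderiv_extChartAt_eq {ξ₀ ξ : Cotangent n M}
    (h : ξ.proj ∈ (chartAt (EuclideanSpace ℝ (Fin n)) ξ₀.proj).source)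
    (v : TangentSpace (coI n) ξ) :
    mfderiv (coI n) 𝓘(ℝ, EuclideanSpace ℝ (Fin n) × CoModel n) (extChartAt (coI n) ξ₀) ξ v =
      ((mfderiv (𝓡 n) 𝓘(ℝ, EuclideanSpace ℝ (Fin n)) (extChartAt (𝓡 n) ξ₀.proj) ξ.proj
        (mfderiv (coI n) (𝓡 n) (Bundle.TotalSpace.proj : Cotangent n M → M) ξ v),
       mfderiv (coI n) 𝓘(ℝ, CoModel n) (fibCoord ξ₀.proj) ξ v) :
        EuclideanSpace ℝ (Fin n) × CoModel n) := by
  have hb : ξ.proj ∈ (trivializationAt (CoModel n) (CotangentSpace n M) ξ₀.proj).baseSet := by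
    simpa using h
  have h1 : ⇑(extChartAt (coI n) ξ₀) =ᶠ[nhds ξ] fun ζ : Cotangent n M =>
      (extChartAt (𝓡 n) ξ₀.proj ζ.proj, fibCoord ξ₀.proj ζ) := by
    have := (trivializationAt (CoModel n) (CotangentSpace n M)
      ξ₀.proj).open_source.mem_nhds ((Bundle.Trivialization.mem_source _).2 hb)
    filter_upwards [this] with ζ hζ
    rw [FiberBundle.extChartAt]
    have h2 := (trivializationAt (CoModel n) (CotangentSpace n M) ξ₀.proj).coe_fst hζ
    exact Prod.ext (congrArg (extChartAt (𝓡 n) ξ₀.proj) h2) rfl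
  have hp : MDifferentiableAt (coI n) (𝓡 n) (Bundle.TotalSpace.proj : Cotangent n M → M) ξ :=
    (Bundle.contMDiff_proj (n := ∞) (CotangentSpace n M)).mdifferentiableAt (by simp)
  have hc : MDifferentiableAt (𝓡 n) 𝓘(ℝ, EuclideanSpace ℝ (Fin n))
      (extChartAt (𝓡 n) ξ₀.proj) ξ.proj := mdifferentiableAt_extChartAt h
  have hf := (contMDiffAt_fibCoord hb).mdifferentiableAt (by simp)
  have hA := hc.hasMFDerivAt.comp ξ hp.hasMFDerivAt
  have h3 : HasMFDerivAt (coI n) 𝓘(ℝ, EuclideanSpace ℝ (Fin n) × CoModel n)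
      (fun ζ : Cotangent n M => (extChartAt (𝓡 n) ξ₀.proj ζ.proj, fibCoord ξ₀.proj ζ)) ξ
      (ContinuousLinearMap.prod _ _) :=
    ⟨ContinuousAt.prodMk hA.1 hf.hasMFDerivAt.1,
      HasFDerivWithinAt.prodMk hA.2 hf.hasMFDerivAt.2⟩
  have h4 := (h3.congr_of_eventuallyEq h1).mfderiv
  exact DFunLike.congr_fun h4 v

/-- A vector field on `T*M` along the fibres is determined by its fibre coordinates. -/
theorem eq_zero_of_coords {ξ₀ ξ : Cotangent n M}
    (h : ξ.proj ∈ (chartAt (EuclideanSpace ℝ (Fin n)) ξ₀.proj).source)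
    {v : TangentSpace (coI n) ξ}
    (h1 : mfderiv (coI n) (𝓡 n) (Bundle.TotalSpace.proj : Cotangent n M → M) ξ v = 0)
    (h2 : mfderiv (coI n) 𝓘(ℝ, CoModel n) (fibCoord ξ₀.proj) ξ v = 0) : v = 0 := by
  have h3 := mfderiv_extChartAt_eq h v
  rw [h1, h2, ContinuousLinearMap.map_zero] at h3
  have h4 : ξ ∈ (extChartAt (coI n) ξ₀).source := by
    rw [FiberBundle.extChartAt]
    have hb : ξ.proj ∈ (trivializationAt (CoModel n) (CotangentSpace n M) ξ₀.proj).baseSet := by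
      simpa using h
    have hs := (Bundle.Trivialization.mem_source _).2 hb
    have h2 := (trivializationAt (CoModel n) (CotangentSpace n M) ξ₀.proj).coe_fst hs
    refine ⟨hs, ?_, trivial⟩
    change (trivializationAt (CoModel n) (CotangentSpace n M) ξ₀.proj ξ).1 ∈
      (extChartAt (𝓡 n) ξ₀.proj).source
    rw [h2, extChartAt_source]
    exact h
  obtain ⟨e, he⟩ := isInvertible_mfderiv_extChartAt h4
  apply e.injective
  have h5 := DFunLike.congr_fun he v
  rw [ContinuousLinearEquiv.map_zero]
  exact h5.trans h3

theorem exists_vlift_of_vertical {ξ : Cotangent n M} {v : TangentSpace (coI n) ξ}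
    (h1 : mfderiv (coI n) (𝓡 n) (Bundle.TotalSpace.proj : Cotangent n M → M) ξ v = 0) :
    ∃ η : CoModel n, vlift ξ η = v := by
  have hb : ξ.proj ∈ (trivializationAt (CoModel n) (CotangentSpace n M) ξ.proj).baseSet :=
    FiberBundle.mem_baseSet_trivializationAt' _
  obtain ⟨η, hη⟩ := (fibEquiv ξ.proj ξ.proj hb).surjective
    (mfderiv (coI n) 𝓘(ℝ, CoModel n) (fibCoord ξ.proj) ξ v)
  refine ⟨η, sub_eq_zero.1 (eq_zero_of_coords (ξ₀ := ξ) (mem_chart_source _ _) ?_ ?_)⟩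
  · rw [ContinuousLinearMap.map_sub, mfderiv_proj_vlift, h1, sub_zero]
  · rw [ContinuousLinearMap.map_sub, sub_eq_zero, mfderiv_fibCoord_vlift hb, fibCoord_incl hb]
    exact hη

theorem vlift_injective (ξ : Cotangent n M) : Function.Injective (vlift ξ) := by
  intro a b hab
  have hb : ξ.proj ∈ (trivializationAt (CoModel n) (CotangentSpace n M) ξ.proj).baseSet :=
    FiberBundle.mem_baseSet_trivializationAt' _
  apply (fibEquiv ξ.proj ξ.proj hb).injective
  rw [← fibCoord_incl hb, ← fibCoord_incl hb, ← mfderiv_fibCoord_vlift hb,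
    ← mfderiv_fibCoord_vlift hb, hab]

theorem triv_vlift {ξ₀ ξ : Cotangent n M}
    (h : ξ.proj ∈ (chartAt (EuclideanSpace ℝ (Fin n)) ξ₀.proj).source)
    (h' : ξ ∈ (chartAt (ModelProd (EuclideanSpace ℝ (Fin n)) (CoModel n)) ξ₀).source)
    (η : CoModel n) :
    (trivializationAt (EuclideanSpace ℝ (Fin n) × CoModel n)
      (TangentSpace (coI n) : Cotangent n M → Type _) ξ₀ ⟨ξ, vlift ξ η⟩).2 =
      ((0, fibCoord ξ₀.proj (fiberIncl ξ.proj η)) : EuclideanSpace ℝ (Fin n) × CoModel n) := by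
  have hb : ξ.proj ∈ (trivializationAt (CoModel n) (CotangentSpace n M) ξ₀.proj).baseSet := by
    simpa using h
  have h3 := DFunLike.congr_fun
    (TangentBundle.continuousLinearMapAt_trivializationAt (I := coI n) h') (vlift ξ η)
  have h4 := mfderiv_extChartAt_eq h (vlift ξ η)
  rw [mfderiv_proj_vlift, mfderiv_fibCoord_vlift hb, ContinuousLinearMap.map_zero] at h4
  have h5 := h3.trans h4
  rw [Bundle.Trivialization.continuousLinearMapAt_apply,
    Bundle.Trivialization.coe_linearMapAt_of_mem] at h5
  · exact h5
  · exact h'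

/-- A fibrewise map `T*M → T*M` with smooth coordinates lifts to a smooth vector field. -/
theorem contMDiff_vlift {c : Cotangent n M → CoModel n}
    (hc : ∀ ξ₀ : Cotangent n M, ContMDiffAt (coI n) 𝓘(ℝ, CoModel n) ∞
      (fun ξ => fibCoord ξ₀.proj (fiberIncl ξ.proj (c ξ))) ξ₀) :
    ContMDiff (coI n) ((coI n).prod 𝓘(ℝ, EuclideanSpace ℝ (Fin n) × CoModel n)) ∞
      (fun ξ => (⟨ξ, vlift ξ (c ξ)⟩ : TangentBundle (coI n) (Cotangent n M))) := by
  intro ξ₀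
  rw [Bundle.contMDiffAt_section]
  have h0 : ContMDiffAt (coI n) 𝓘(ℝ, EuclideanSpace ℝ (Fin n) × CoModel n) ∞
      (fun ξ => ((0, fibCoord ξ₀.proj (fiberIncl ξ.proj (c ξ))) :
        EuclideanSpace ℝ (Fin n) × CoModel n)) ξ₀ :=
    ContMDiffAt.prodMk_space contMDiffAt_const (hc ξ₀)
  refine h0.congr_of_eventuallyEq ?_
  have hs : ∀ᶠ ξ : Cotangent n M in nhds ξ₀,
      ξ.proj ∈ (chartAt (EuclideanSpace ℝ (Fin n)) ξ₀.proj).source :=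
    (Bundle.contMDiff_proj (IB := 𝓡 n) (n := ∞) (CotangentSpace n M)).continuous.continuousAt
      ((chartAt (EuclideanSpace ℝ (Fin n)) ξ₀.proj).open_source.mem_nhds (mem_chart_source _ _))
  have hs' := (chartAt (ModelProd (EuclideanSpace ℝ (Fin n)) (CoModel n)) ξ₀).open_source.mem_nhds
    (mem_chart_source _ _)
  filter_upwards [hs, hs'] with ξ h1 h2
  exact triv_vlift h1 h2 (c ξ)

variable (n M) in
/-- `𝒜 = Γ(𝒱(M))`: smooth vector fields on `T*M` that are tangent to the fibres of `T*M → M`, that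
is, the sections of the subbundle `𝒱(M) = ker dp ⊆ T(T*M)`. -/
def verticalSubmodule : Submodule ℝ (CoVectorFields n M) where
  carrier := {s | ∀ ξ, mfderiv (coI n) (𝓡 n)
    (Bundle.TotalSpace.proj : Cotangent n M → M) ξ (s ξ) = 0}
  add_mem' {a b} ha hb ξ := by
    rw [ContMDiffSection.coe_add, Pi.add_apply, ContinuousLinearMap.map_add, ha ξ, hb ξ, add_zero]
  zero_mem' ξ := by
    rw [ContMDiffSection.coe_zero, Pi.zero_apply, ContinuousLinearMap.map_zero]
  smul_mem' c a ha ξ := by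
    rw [ContMDiffSection.coe_smul, Pi.smul_apply, ContinuousLinearMap.map_smul, ha ξ, smul_zero]

variable (n M) in
/-- The vector space `𝒜 = Γ(𝒱(M))` of vertical vector fields on `T*M`. -/
abbrev VerticalFields := ↥(verticalSubmodule n M)

/-- The covector whose vertical lift is the value at `ξ` of the vertical field `s`. -/
noncomputable def vcomp (s : VerticalFields n M) (ξ : Cotangent n M) : CoModel n :=
  (exists_vlift_of_vertical (s.2 ξ)).choose

theorem vlift_vcomp (s : VerticalFields n M) (ξ : Cotangent n M) :
    vlift ξ (vcomp s ξ) = (s : CoVectorFields n M) ξ :=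
  (exists_vlift_of_vertical (s.2 ξ)).choose_spec

/-- A vertical vector field restricted to the vector space `T*_q M`, as a vector field on that
vector space. -/
noncomputable def vfib (s : VerticalFields n M) (q : M) (p : CoModel n) : CoModel n :=
  vcomp s (fiberIncl q p)

theorem vertical_ext {s t : VerticalFields n M} (h : ∀ ξ, vcomp s ξ = vcomp t ξ) : s = t := by
  apply Subtype.ext
  apply ContMDiffSection.ext
  intro ξ
  rw [← vlift_vcomp, ← vlift_vcomp, h]

theorem vcomp_add (s t : VerticalFields n M) (ξ : Cotangent n M) :
    vcomp (s + t) ξ = vcomp s ξ + vcomp t ξ := by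
  apply vlift_injective ξ
  rw [ContinuousLinearMap.map_add, vlift_vcomp, vlift_vcomp, vlift_vcomp]
  rfl

theorem vcomp_smul (c : ℝ) (s : VerticalFields n M) (ξ : Cotangent n M) :
    vcomp (c • s) ξ = c • vcomp s ξ := by
  apply vlift_injective ξ
  rw [ContinuousLinearMap.map_smul, vlift_vcomp, vlift_vcomp]
  rfl

theorem fibCoord_vcomp {q : M} {ξ : Cotangent n M}
    (h : ξ.proj ∈ (trivializationAt (CoModel n) (CotangentSpace n M) q).baseSet)
    (s : VerticalFields n M) :
    fibCoord q (fiberIncl ξ.proj (vcomp s ξ)) =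
      mfderiv (coI n) 𝓘(ℝ, CoModel n) (fibCoord q) ξ ((s : CoVectorFields n M) ξ) := by
  rw [← mfderiv_fibCoord_vlift h, vlift_vcomp]

theorem eventually_baseSet (q : M) {ξ : Cotangent n M}
    (h : ξ.proj ∈ (trivializationAt (CoModel n) (CotangentSpace n M) q).baseSet) :
    ∀ᶠ ζ : Cotangent n M in nhds ξ,
      ζ.proj ∈ (trivializationAt (CoModel n) (CotangentSpace n M) q).baseSet :=
  (Bundle.contMDiff_proj (IB := 𝓡 n) (n := ∞) (CotangentSpace n M)).continuous.continuousAt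
    ((trivializationAt (CoModel n) (CotangentSpace n M) q).open_baseSet.mem_nhds h)

theorem contMDiffAt_fibCoord_vcomp {q : M} {ξ : Cotangent n M}
    (h : ξ.proj ∈ (trivializationAt (CoModel n) (CotangentSpace n M) q).baseSet)
    (s : VerticalFields n M) :
    ContMDiffAt (coI n) 𝓘(ℝ, CoModel n) ∞
      (fun ζ => fibCoord q (fiberIncl ζ.proj (vcomp s ζ))) ξ := by
  refine (contMDiffAt_dirDeriv (s : CoVectorFields n M)
    (contMDiffAt_fibCoord h)).congr_of_eventuallyEq ?_
  filter_upwards [eventually_baseSet q h] with ζ hζ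
  exact fibCoord_vcomp hζ s

theorem contDiff_vfib (s : VerticalFields n M) (q : M) : ContDiff ℝ ∞ (vfib s q) := by
  have hb : q ∈ (trivializationAt (CoModel n) (CotangentSpace n M) q).baseSet :=
    FiberBundle.mem_baseSet_trivializationAt' _
  have h1 : ContMDiff 𝓘(ℝ, CoModel n) 𝓘(ℝ, CoModel n) ∞
      (fun p : CoModel n => fibEquiv q q hb (vfib s q p)) := fun p =>
    (contMDiffAt_fibCoord_vcomp (ξ := fiberIncl q p) hb s).comp p (contMDiff_fiberIncl q p)
  have h2 := (fibEquiv (n := n) q q hb).symm.contDiff.comp h1.contDiff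
  have h3 : vfib s q = (fibEquiv (n := n) q q hb).symm ∘
      fun p => fibEquiv q q hb (vfib s q p) := by
    funext p; simp
  rw [h3]
  exact h2

/-- Fibre component of the product of vertical fields: at `ξ`, the derivative of `s'`, restricted
to the vector space `T*_q M`, in the direction of `s`. -/
noncomputable def mulComp (s s' : VerticalFields n M) (ξ : Cotangent n M) : CoModel n :=
  fderiv ℝ (vfib s' ξ.proj) (fibPt ξ) (vcomp s ξ)

theorem contMDiffAt_mulComp (s s' : VerticalFields n M) (ξ₀ : Cotangent n M) :
    ContMDiffAt (coI n) 𝓘(ℝ, CoModel n) ∞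
      (fun ξ => fibCoord ξ₀.proj (fiberIncl ξ.proj (mulComp s s' ξ))) ξ₀ := by
  have hb : ξ₀.proj ∈ (trivializationAt (CoModel n) (CotangentSpace n M) ξ₀.proj).baseSet :=
    FiberBundle.mem_baseSet_trivializationAt' _
  refine (contMDiffAt_dirDeriv (s : CoVectorFields n M)
    (contMDiffAt_fibCoord_vcomp hb s')).congr_of_eventuallyEq ?_
  filter_upwards [eventually_baseSet ξ₀.proj hb] with ξ hξ
  rw [← vlift_vcomp, fibCoord_incl hξ]
  refine Eq.trans ?_ (mfderiv_vlift (contMDiffAt_fibCoord_vcomp hξ s') (vcomp s ξ)).symm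
  have h1 : HasFDerivAt (vfib s' ξ.proj) (fderiv ℝ (vfib s' ξ.proj) (fibPt ξ)) (fibPt ξ) :=
    ((contDiff_vfib s' ξ.proj).differentiable (by simp) _).hasFDerivAt
  have h2 := (fibEquiv ξ₀.proj ξ.proj hξ : CoModel n →L[ℝ] CoModel n).hasFDerivAt.comp _ h1
  exact (DFunLike.congr_fun h2.fderiv (vcomp s ξ)).symm

/-- The product `s s' = D_s s'` of `𝒜 = Γ(𝒱(M))`, where `D` is the canonical flat connection of the
leaves `T*_q M` (the usual derivative of vector fields on the vector space `T*_q M`). -/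
noncomputable instance : Mul (VerticalFields n M) where
  mul s s' := ⟨⟨fun ξ => vlift ξ (mulComp s s' ξ), contMDiff_vlift (contMDiffAt_mulComp s s')⟩,
    fun ξ => mfderiv_proj_vlift ξ _⟩

theorem vcomp_mul (s s' : VerticalFields n M) (ξ : Cotangent n M) :
    vcomp (s * s') ξ = mulComp s s' ξ := by
  apply vlift_injective ξ
  rw [vlift_vcomp]
  rfl

theorem vfib_add (s t : VerticalFields n M) (q : M) :
    vfib (s + t) q = fun p => vfib s q p + vfib t q p := by
  funext p; exact vcomp_add s t _

theorem vfib_smul (c : ℝ) (s : VerticalFields n M) (q : M) :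
    vfib (c • s) q = fun p => c • vfib s q p := by
  funext p; exact vcomp_smul c s _

theorem vfib_zero (q : M) : vfib (0 : VerticalFields n M) q = fun _ => 0 := by
  funext p
  apply vlift_injective (fiberIncl q p)
  rw [ContinuousLinearMap.map_zero]
  exact vlift_vcomp 0 _

theorem vfib_mul (s t : VerticalFields n M) (q : M) :
    vfib (s * t) q = fun p => fderiv ℝ (vfib t q) p (vfib s q p) := by
  funext p; exact vcomp_mul s t _

theorem vertical_ext_fib {s t : VerticalFields n M} (h : ∀ q p, vfib s q p = vfib t q p) :
    s = t :=
  vertical_ext fun ξ => h ξ.proj (fibPt ξ)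

theorem differentiable_vfib (s : VerticalFields n M) (q : M) : Differentiable ℝ (vfib s q) :=
  (contDiff_vfib s q).differentiable (by simp)

/-- Left symmetry of the flat connection of a vector space. -/
theorem flat_left_symm {V W : Type*} [NormedAddCommGroup V] [NormedSpace ℝ V]
    [NormedAddCommGroup W] [NormedSpace ℝ W] {a b : V → V} {u : V → W} (ha : ContDiff ℝ ∞ a)
    (hb : ContDiff ℝ ∞ b) (hu : ContDiff ℝ ∞ u) (p : V) :
    fderiv ℝ u p (fderiv ℝ b p (a p)) - fderiv ℝ (fun x => fderiv ℝ u x (b x)) p (a p) =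
      fderiv ℝ u p (fderiv ℝ a p (b p)) - fderiv ℝ (fun x => fderiv ℝ u x (a x)) p (b p) := by
  have hd : DifferentiableAt ℝ (fderiv ℝ u) p :=
    (hu.fderiv_right (m := ∞) (by simp)).differentiable (by simp) p
  have key : ∀ c : V → V, ContDiff ℝ ∞ c → ∀ v, fderiv ℝ (fun x => fderiv ℝ u x (c x)) p v =
      fderiv ℝ (fderiv ℝ u) p v (c p) + fderiv ℝ u p (fderiv ℝ c p v) := by
    intro c hc v
    rw [(hd.hasFDerivAt.clm_apply (hc.differentiable (by simp) p).hasFDerivAt).fderiv]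
    simp [add_comm]
  have hsym : IsSymmSndFDerivAt ℝ u p := hu.contDiffAt.isSymmSndFDerivAt (by
    rw [minSmoothness_of_isRCLikeNormedField]
    exact WithTop.coe_le_coe.2 (le_top : (2 : ℕ∞) ≤ ⊤))
  rw [key b hb, key a ha, hsym.eq (a p) (b p)]
  abel

noncomputable instance : LeftPreLieRing (VerticalFields n M) where
  left_distrib a b c := vertical_ext_fib fun q p => by
    have h := DFunLike.congr_fun
      (fderiv_fun_add (differentiable_vfib b q p) (differentiable_vfib c q p)) (vfib a q p)
    simpa only [vfib_add, vfib_mul, add_apply] using h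
  right_distrib a b c := vertical_ext_fib fun q p => by
    simp only [vfib_add, vfib_mul, map_add]
  zero_mul a := vertical_ext_fib fun q p => by
    simp only [vfib_zero, vfib_mul, map_zero]
  mul_zero a := vertical_ext_fib fun q p => by
    simp only [vfib_zero, vfib_mul, fderiv_fun_const]
    rfl
  assoc_symm' a b c := vertical_ext_fib fun q p => by
    have h := flat_left_symm (contDiff_vfib a q) (contDiff_vfib b q) (contDiff_vfib c q) p
    have hs : ∀ s t : VerticalFields n M, s - t = s + (-1 : ℝ) • t := by
      intro s t; simp [sub_eq_add_neg]
    simp only [associator_apply, hs, vfib_add, vfib_smul, vfib_mul]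
    simpa [sub_eq_add_neg] using h

noncomputable instance : LeftPreLieAlgebra ℝ (VerticalFields n M) where
  smul_assoc r a b := vertical_ext_fib fun q p => by
    simp only [smul_eq_mul, vfib_smul, vfib_mul, map_smul]
  smul_comm r a b := vertical_ext_fib fun q p => by
    have h := DFunLike.congr_fun
      (fderiv_fun_const_smul (differentiable_vfib b q p) r) (vfib a q p)
    simpa only [smul_eq_mul, vfib_smul, vfib_mul, smul_apply] using h.symm

instance : IsScalarTower ℝ (VerticalFields n M) (VerticalFields n M) :=
  LeftPreLieAlgebra.toIsScalarTower

instance : SMulCommClass ℝ (VerticalFields n M) (VerticalFields n M) :=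
  LeftPreLieAlgebra.toSMulCommClass

/-- The derivative `Y f = df(Y)` of a function on `T*M` along a vector field on `T*M`. -/
noncomputable def lieFun (Y : CoVectorFields n M) (f : CoFunctions n M) : CoFunctions n M :=
  ⟨fun ξ => mfderiv (coI n) 𝓘(ℝ, ℝ) f ξ (Y ξ), fun ξ => contMDiffAt_dirDeriv Y (f.contMDiff ξ)⟩

theorem lieFun_add_left (Y Z : CoVectorFields n M) (f : CoFunctions n M) :
    lieFun (Y + Z) f = lieFun Y f + lieFun Z f :=
  ContMDiffMap.ext fun ξ => ContinuousLinearMap.map_add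
    (mfderiv (coI n) 𝓘(ℝ, ℝ) f ξ) (Y ξ) (Z ξ)

theorem lieFun_smul_left (c : ℝ) (Y : CoVectorFields n M) (f : CoFunctions n M) :
    lieFun (c • Y) f = c • lieFun Y f :=
  ContMDiffMap.ext fun ξ => ContinuousLinearMap.map_smul
    (mfderiv (coI n) 𝓘(ℝ, ℝ) f ξ) c (Y ξ)

theorem lieFun_add_right (Y : CoVectorFields n M) (f g : CoFunctions n M) :
    lieFun Y (f + g) = lieFun Y f + lieFun Y g :=
  ContMDiffMap.ext fun ξ => by
    have h := mfderiv_add (f.mdifferentiableAt (x := ξ)) (g.mdifferentiableAt (x := ξ))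
    exact DFunLike.congr_fun h (Y ξ)

theorem lieFun_smul_right (c : ℝ) (Y : CoVectorFields n M) (f : CoFunctions n M) :
    lieFun Y (c • f) = c • lieFun Y f :=
  ContMDiffMap.ext fun ξ => by
    have h := const_smul_mfderiv (f.mdifferentiableAt (x := ξ)) c
    exact DFunLike.congr_fun h (Y ξ)

theorem lieFun_mul (Y : CoVectorFields n M) (f g : CoFunctions n M) :
    lieFun Y (f * g) = f * lieFun Y g + g * lieFun Y f :=
  ContMDiffMap.ext fun ξ => by
    have h := (f.mdifferentiableAt (x := ξ)).hasMFDerivAt.mul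
      (g.mdifferentiableAt (x := ξ)).hasMFDerivAt
    exact DFunLike.congr_fun h.mfderiv (Y ξ)

theorem contDiff_fiber (f : CoFunctions n M) (q : M) :
    ContDiff ℝ ∞ (fun p : CoModel n => f (fiberIncl q p)) :=
  (f.contMDiff.comp (contMDiff_fiberIncl q)).contDiff

theorem lieFun_vertical (s : VerticalFields n M) (f : CoFunctions n M) (q : M) (p : CoModel n) :
    lieFun (s : CoVectorFields n M) f (fiberIncl q p) =
      fderiv ℝ (fun p' : CoModel n => f (fiberIncl q p')) p (vfib s q p) := by
  have h := mfderiv_vlift (f.contMDiff (fiberIncl q p)) (vcomp s (fiberIncl q p))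
  rw [vlift_vcomp] at h
  exact h

theorem lieFun_left_symm (a b : VerticalFields n M) (f : CoFunctions n M) :
    lieFun (↑(a * b)) f - lieFun (a : CoVectorFields n M) (lieFun b f) =
      lieFun (↑(b * a)) f - lieFun (b : CoVectorFields n M) (lieFun a f) :=
  ContMDiffMap.ext fun ξ => by
    have h := flat_left_symm (contDiff_vfib a ξ.proj) (contDiff_vfib b ξ.proj)
      (contDiff_fiber f ξ.proj) (fibPt ξ)
    have h1 := lieFun_vertical (a * b) f ξ.proj (fibPt ξ)
    have h2 := lieFun_vertical (b * a) f ξ.proj (fibPt ξ)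
    have h3 := (lieFun_vertical a (lieFun b f) ξ.proj (fibPt ξ)).trans
      (by rw [show (fun p' => lieFun (b : CoVectorFields n M) f (fiberIncl ξ.proj p')) = _ from
        funext (lieFun_vertical b f ξ.proj)])
    have h4 := (lieFun_vertical b (lieFun a f) ξ.proj (fibPt ξ)).trans
      (by rw [show (fun p' => lieFun (a : CoVectorFields n M) f (fiberIncl ξ.proj p')) = _ from
        funext (lieFun_vertical a f ξ.proj)])
    simp only [vfib_mul] at h1 h2
    rw [← h1, ← h2, ← h3, ← h4] at h
    exact h

variable (n M) in
/-- The underlying vector space `𝒜 ⊕ C^∞(T*M)` of the algebra `𝒢`: sections of the Whitney sum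
of `𝒱(M)` and the trivial line bundle over `T*M`. -/
def CoAlgebra := VerticalFields n M × CoFunctions n M

noncomputable instance : AddCommGroup (CoAlgebra n M) :=
  inferInstanceAs (AddCommGroup (VerticalFields n M × CoFunctions n M))

noncomputable instance : Module ℝ (CoAlgebra n M) :=
  inferInstanceAs (Module ℝ (VerticalFields n M × CoFunctions n M))

/-- The product `(s, f)(s', f') = (s s', f f' + s · f')` of `𝒢`. -/
noncomputable instance : Mul (CoAlgebra n M) where
  mul x y := (x.1 * y.1, x.2 * y.2 + lieFun (x.1 : CoVectorFields n M) y.2)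

theorem CoAlgebra.mul_def (x y : CoAlgebra n M) :
    x * y = (x.1 * y.1, x.2 * y.2 + lieFun (x.1 : CoVectorFields n M) y.2) := rfl

theorem CoAlgebra.ext {x y : CoAlgebra n M} (h1 : x.1 = y.1) (h2 : x.2 = y.2) : x = y :=
  Prod.ext h1 h2

/-- `𝒢` is a Koszul–Vinberg algebra, that is, a left pre-Lie algebra. -/
noncomputable instance : LeftPreLieRing (CoAlgebra n M) where
  left_distrib a b c := CoAlgebra.ext (mul_add a.1 b.1 c.1) (by
    change a.2 * (b.2 + c.2) + lieFun _ (b.2 + c.2) =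
      (a.2 * b.2 + lieFun _ b.2) + (a.2 * c.2 + lieFun _ c.2)
    rw [lieFun_add_right, mul_add]; abel)
  right_distrib a b c := CoAlgebra.ext (add_mul a.1 b.1 c.1) (by
    change (a.2 + b.2) * c.2 + lieFun (a.1.1 + b.1.1) c.2 =
      (a.2 * c.2 + lieFun _ c.2) + (b.2 * c.2 + lieFun _ c.2)
    rw [lieFun_add_left, add_mul]; abel)
  zero_mul a := CoAlgebra.ext (zero_mul a.1) (by
    change 0 * a.2 + lieFun (0 : CoVectorFields n M) a.2 = 0
    rw [← zero_smul ℝ (0 : CoVectorFields n M), lieFun_smul_left]; simp)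
  mul_zero a := CoAlgebra.ext (mul_zero a.1) (by
    change a.2 * 0 + lieFun _ (0 : CoFunctions n M) = 0
    rw [← zero_smul ℝ (0 : CoFunctions n M), lieFun_smul_right]; simp)
  assoc_symm' a b c := CoAlgebra.ext (LeftPreLieRing.assoc_symm a.1 b.1 c.1) (by
    have h := lieFun_left_symm a.1 b.1 c.2
    change ((a.2 * b.2 + lieFun _ b.2) * c.2 + lieFun _ c.2) -
        (a.2 * (b.2 * c.2 + lieFun _ c.2) + lieFun _ (b.2 * c.2 + lieFun _ c.2)) =
      ((b.2 * a.2 + lieFun _ a.2) * c.2 + lieFun _ c.2) -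
        (b.2 * (a.2 * c.2 + lieFun _ c.2) + lieFun _ (a.2 * c.2 + lieFun _ c.2))
    rw [lieFun_add_right, lieFun_add_right, lieFun_mul, lieFun_mul]
    change lieFun (↑(a.1 * b.1)) c.2 - _ = lieFun (↑(b.1 * a.1)) c.2 - _ at h
    linear_combination h)

noncomputable instance : LeftPreLieAlgebra ℝ (CoAlgebra n M) where
  smul_assoc r a b := CoAlgebra.ext (smul_mul_assoc r a.1 b.1) (by
    refine (congrArg (fun z => (r • a.2) * b.2 + z) (lieFun_smul_left r a.1.1 b.2)).trans ?_
    change _ = r • (a.2 * b.2 + lieFun a.1.1 b.2)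
    rw [smul_add, smul_mul_assoc])
  smul_comm r a b := CoAlgebra.ext (mul_smul_comm r a.1 b.1).symm (by
    change r • (a.2 * b.2 + lieFun _ b.2) = a.2 * (r • b.2) + lieFun _ (r • b.2)
    rw [lieFun_smul_right, smul_add, mul_smul_comm])

/-- `Y` is the cotangent lift of the vector field `X` on `M`: `Y` projects to `X`, and
`Y ℓ_Z = ℓ_{[X, Z]}` for every vector field `Z` on `M`, where `ℓ_Z(ξ) = ξ(Z)` is the fibrewise
linear function defined by `Z`. Equivalently, the flow of `Y` is the flow on `T*M` induced by the
flow of `X`. -/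
def IsCotangentLift (X : VectorFields n M) (Y : CoVectorFields n M) : Prop :=
  (∀ ξ, mfderiv (coI n) (𝓡 n) (Bundle.TotalSpace.proj : Cotangent n M → M) ξ (Y ξ) = X ξ.proj) ∧
  ∀ (Z : VectorFields n M) (ξ : Cotangent n M),
    mfderiv (coI n) 𝓘(ℝ, ℝ) (fun ζ : Cotangent n M => (ζ.snd (Z ζ.proj) : ℝ)) ξ (Y ξ) =
      (ξ.snd (VectorField.mlieBracket (𝓡 n) X Z ξ.proj) : ℝ)

/-- `θ` is the Lie derivative along `Y`, acting on `𝒢` by `(s, f) ↦ ([Y, s], Y f)`. -/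
def IsLieDerivative (Y : CoVectorFields n M) (θ : CoAlgebra n M →ₗ[ℝ] CoAlgebra n M) : Prop :=
  ∀ x : CoAlgebra n M,
    (∀ ξ, ((θ x).1 : CoVectorFields n M) ξ =
      VectorField.mlieBracket (coI n) Y (x.1 : CoVectorFields n M) ξ) ∧
    (θ x).2 = lieFun Y x.2

end Vertical

section Homology

variable (R A : Type*) [CommRing R] [LeftPreLieRing A] [LeftPreLieAlgebra R A]

/-- `J(A) = {c | (a, b, c) = 0 for all a, b}`. -/
def jacobiElements : Submodule R A where
  carrier := {c | ∀ a b : A, associator a b c = 0}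
  add_mem' {x y} hx hy a b := by
    have h1 := hx a b
    have h2 := hy a b
    rw [associator_apply] at *
    rw [mul_add, mul_add, mul_add, add_sub_add_comm, h1, h2, add_zero]
  zero_mem' a b := by simp [associator_apply]
  smul_mem' r x hx a b := by
    have h1 := hx a b
    rw [associator_apply] at *
    rw [mul_smul_comm, mul_smul_comm, mul_smul_comm, ← smul_sub, h1, smul_zero]

/-- `δ₀ : J(A) → C₁(A, A) = Hom(A, A)`, `(δ₀ w)(a) = -a w + w a`. -/
def delta0 : jacobiElements R A →ₗ[R] (A →ₗ[R] A) :=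
  (LinearMap.mul R A - (LinearMap.mul R A).flip) ∘ₗ (jacobiElements R A).subtype

/-- `δ₁ : C₁(A, A) → C₂(A, A) = Hom(A ⊗ A, A)`,
`(δ₁ θ)(a, b) = -((a θ)(b) + θ(a) b)` with `(a θ)(b) = a θ(b) - θ(a b)`. -/
def delta1 : (A →ₗ[R] A) →ₗ[R] (A →ₗ[R] A →ₗ[R] A) where
  toFun θ := LinearMap.mk₂ R (fun a b => -((a * θ b - θ (a * b)) + θ a * b))
    (by intros; simp only [add_mul, map_add]; abel)
    (by intros; simp only [smul_mul_assoc, map_smul, smul_add, smul_sub, smul_neg])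
    (by intros; simp only [mul_add, map_add]; abel)
    (by intros; simp only [mul_smul_comm, map_smul, smul_add, smul_sub, smul_neg])
  map_add' θ η := by
    ext a b
    simp only [LinearMap.mk₂_apply, LinearMap.add_apply, mul_add, add_mul]
    abel
  map_smul' r θ := by
    ext a b
    simp only [LinearMap.mk₂_apply, LinearMap.smul_apply, mul_smul_comm, smul_mul_assoc,
      RingHom.id_apply, smul_add, smul_sub, smul_neg]

theorem delta1_delta0 (w : jacobiElements R A) : delta1 R A (delta0 R A w) = 0 := by
  ext a b
  have h1 := w.2 a b
  have h2 := LeftPreLieRing.assoc_symm a (w : A) b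
  simp only [associator_apply] at h1 h2
  change -((a * ((w : A) * b - b * w) - ((w : A) * (a * b) - (a * b) * w)) +
    ((w : A) * a - a * w) * b) = 0
  rw [mul_sub, sub_mul]
  have h3 : a * (w * b) = a * w * b - (w * a * b - w * (a * b)) := by rw [← h2]; abel
  rw [h3, ← sub_eq_zero.1 h1]
  abel

/-- The space `ker δ₁` of 1-cycles. -/
abbrev cycles1 : Submodule R (A →ₗ[R] A) := LinearMap.ker (delta1 R A)

/-- The space `im δ₀`, inside the 1-cycles. -/
def boundaries1 : Submodule R (cycles1 R A) :=
  LinearMap.range ((delta0 R A).codRestrict (cycles1 R A) fun w =>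
    LinearMap.mem_ker.2 (delta1_delta0 R A w))

/-- `H₁(A, A) = ker δ₁ / im δ₀`: the first homology of the Koszul–Vinberg algebra `A` with
coefficients in itself. -/
abbrev H1 := cycles1 R A ⧸ boundaries1 R A

end Homology

/-- `H₁(𝒱(M)) = H₁(𝒢, 𝒢)`: the first homology of the cotangent Koszul–Vinberg algebroid. -/
abbrev CotangentH1 (n : ℕ) (M : Type*) [TopologicalSpace M]
    [ChartedSpace (EuclideanSpace ℝ (Fin n)) M] [IsManifold (𝓡 n) ∞ M] :=
  H1 ℝ (CoAlgebra n M)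

end KV

/-! Lift. Choose any tangent vector `v` of `T*M` at `ξ` over the value of `X`. Then `Z ↦ v ℓ_Z -
ℓ_{[X,Z]}(ξ)` is linear over functions, because the Leibniz terms cancel, so it is evaluation of a
covector `η` at the base point; `v - vlift ξ η` is the value of the lift. It is the only one, since
a vertical vector killing every `ℓ_Z` vanishes. Smoothness follows because fibre coordinates are
locally functions `ℓ_Z`, whose derivatives along the lift are the smooth functions `ℓ_{[X,Z]}`.

Cycle. The condition `δ₁θ = 0` says exactly that `θ` is a derivation of `𝒢`. A vertical field is
determined by its action on the functions `ℓ_Z`, and on them `D_s t` acts as the composite `s ∘ t`,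
since `ℓ_Z` is linear on each fibre. As a cotangent lift permutes the `ℓ_Z` among themselves, the
derivation property becomes the commutator identity `[Y, st] = [Y, s]t + s[Y, t]`. The bracket acts
on functions as a commutator by `dirD_mlieBracket`.

Injectivity. On an element `(0, g ∘ p)` a boundary has zero function component, while the Lie
derivative gives `(X g) ∘ p`. Hence `X g = 0` for every smooth `g`, so `X = 0`.

Dimension. By injectivity it is enough that `Γ(TM)` is infinite-dimensional. Otherwise
multiplication by any smooth function would have a minimal polynomial, and the function would take
finitely many values and be locally constant; but differentials of functions separate tangent
vectors.

The Hausdorff condition enters through bump functions, which globalize local fields and functions.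
-/

namespace KV

/-! ### Directional derivatives and the Lie bracket as a commutator on functions -/

section Bracket

variable {EN HN N : Type*} [NormedAddCommGroup EN] [NormedSpace ℝ EN] [TopologicalSpace HN]
  {J : ModelWithCorners ℝ EN HN} [TopologicalSpace N] [ChartedSpace HN N]

/-- The derivative of a real function in the direction of a tangent vector. -/
noncomputable def dirD (f : N → ℝ) {x : N} (v : TangentSpace J x) : ℝ :=
  mfderiv J 𝓘(ℝ, ℝ) f x v

theorem dirD_add_right (f : N → ℝ) {x : N} (v w : TangentSpace J x) :
    dirD f (v + w) = dirD f v + dirD f w :=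
  (mfderiv J 𝓘(ℝ, ℝ) f x).map_add v w

theorem dirD_sub_right (f : N → ℝ) {x : N} (v w : TangentSpace J x) :
    dirD f (v - w) = dirD f v - dirD f w :=
  (mfderiv J 𝓘(ℝ, ℝ) f x).map_sub v w

theorem dirD_zero_right (f : N → ℝ) {x : N} : dirD f (0 : TangentSpace J x) = 0 :=
  (mfderiv J 𝓘(ℝ, ℝ) f x).map_zero

theorem dirD_congr {f g : N → ℝ} {x : N} (h : f =ᶠ[nhds x] g) (v : TangentSpace J x) :
    dirD f v = dirD g v :=
  DFunLike.congr_fun (h.mfderiv_eq (I := J) (I' := 𝓘(ℝ, ℝ))) v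

theorem dirD_const (c : ℝ) {x : N} (v : TangentSpace J x) : dirD (fun _ : N => c) v = 0 :=
  DFunLike.congr_fun (mfderiv_const (I := J) (I' := 𝓘(ℝ, ℝ)) (c := c) (x := x)) v

theorem dirD_add {f g : N → ℝ} {x : N} (hf : MDifferentiableAt J 𝓘(ℝ, ℝ) f x)
    (hg : MDifferentiableAt J 𝓘(ℝ, ℝ) g x) (v : TangentSpace J x) :
    dirD (fun y => f y + g y) v = dirD f v + dirD g v :=
  DFunLike.congr_fun (hf.hasMFDerivAt.add hg.hasMFDerivAt).mfderiv v

theorem dirD_mul {f g : N → ℝ} {x : N} (hf : MDifferentiableAt J 𝓘(ℝ, ℝ) f x)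
    (hg : MDifferentiableAt J 𝓘(ℝ, ℝ) g x) (v : TangentSpace J x) :
    dirD (fun y => f y * g y) v = f x * dirD g v + dirD f v * g x := by
  have h := DFunLike.congr_fun (hf.hasMFDerivAt.mul hg.hasMFDerivAt).mfderiv v
  exact h.trans (congrArg (f x * dirD g v + ·) (mul_comm (g x) (dirD f v)))

variable [IsManifold J ∞ N]

/-- Smoothness at a point of a vector field that need not be smooth everywhere. -/
def SmoothFieldAt (W : ∀ x : N, TangentSpace J x) (x : N) : Prop :=
  ContMDiffAt J (J.prod 𝓘(ℝ, EN)) ∞ (fun y => (⟨y, W y⟩ : TangentBundle J N)) x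

theorem SmoothFieldAt.mdiff {W : ∀ x : N, TangentSpace J x} {x : N} (hW : SmoothFieldAt W x) :
    ∀ᶠ y in nhds x, MDifferentiableAt J (J.prod 𝓘(ℝ, EN))
      (fun y => (⟨y, W y⟩ : TangentBundle J N)) y := by
  have : IsManifold J 1 N := IsManifold.of_le (n := ∞) (by simp)
  have : IsManifold (J.prod 𝓘(ℝ, EN)) 1 (TangentBundle J N) :=
    IsManifold.of_le (n := ∞) (by simp)
  have h1 : ContMDiffAt J (J.prod 𝓘(ℝ, EN)) 1 (fun y => (⟨y, W y⟩ : TangentBundle J N)) x :=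
    ContMDiffAt.of_le hW (by simp)
  filter_upwards [(contMDiffAt_iff_contMDiffAt_nhds (by simp)).1 h1] with y hy using hy.mdifferentiableAt (by simp)

theorem eventually_mdifferentiableAt {f : N → ℝ} {x : N} (hf : ContMDiffAt J 𝓘(ℝ, ℝ) ∞ f x) :
    ∀ᶠ y in nhds x, MDifferentiableAt J 𝓘(ℝ, ℝ) f y := by
  have : IsManifold J 1 N := IsManifold.of_le (n := ∞) (by simp)
  have h1 : ContMDiffAt J 𝓘(ℝ, ℝ) 1 f x := hf.of_le (by simp)
  filter_upwards [(contMDiffAt_iff_contMDiffAt_nhds (by simp)).1 h1] with y hy using hy.mdifferentiableAt (by simp)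

theorem SmoothFieldAt.smul {W : ∀ x : N, TangentSpace J x} {f : N → ℝ} {x : N}
    (hf : ContMDiffAt J 𝓘(ℝ, ℝ) ∞ f x) (hW : SmoothFieldAt W x) :
    SmoothFieldAt (fun y => f y • W y) x :=
  ContMDiffAt.smul_section hf hW

theorem contMDiffAt_dirD (Y : Cₛ^∞⟮J; EN, (TangentSpace J : N → Type _)⟯) {r : N → ℝ} {x : N}
    (hr : ContMDiffAt J 𝓘(ℝ, ℝ) ∞ r x) :
    ContMDiffAt J 𝓘(ℝ, ℝ) ∞ (fun y => dirD r (Y y)) x :=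
  contMDiffAt_dirDeriv Y hr

variable [CompleteSpace EN]

theorem SmoothFieldAt.mlieBracket {V W : ∀ x : N, TangentSpace J x} {x : N}
    (hV : SmoothFieldAt V x) (hW : SmoothFieldAt W x) :
    SmoothFieldAt (VectorField.mlieBracket J V W) x := by
  have : IsManifold J (((⊤ : ℕ∞) : WithTop ℕ∞) + 1) N := ‹IsManifold J ∞ N›
  have : IsManifold J (minSmoothness ℝ 2) N := IsManifold.of_le (n := ∞) (by
    rw [minSmoothness_of_isRCLikeNormedField]
    exact WithTop.coe_le_coe.2 (le_top : (2 : ℕ∞) ≤ ⊤))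
  exact ContMDiffAt.mlieBracket_vectorField (m := ⊤) (n := ⊤) hV hW
    (by rw [minSmoothness_of_isRCLikeNormedField]; rfl)

/-- The Lie bracket of smooth vector fields. -/
noncomputable def bracket (V W : Cₛ^∞⟮J; EN, (TangentSpace J : N → Type _)⟯) :
    Cₛ^∞⟮J; EN, (TangentSpace J : N → Type _)⟯ :=
  ⟨VectorField.mlieBracket J V W, fun x =>
    SmoothFieldAt.mlieBracket (V.contMDiff x) (W.contMDiff x)⟩

theorem mlieBracket_smul (V : ∀ x : N, TangentSpace J x) {W : ∀ x : N, TangentSpace J x}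
    {f : N → ℝ} {x : N} (hf : MDifferentiableAt J 𝓘(ℝ, ℝ) f x)
    (hW : MDifferentiableAt J (J.prod 𝓘(ℝ, EN)) (fun y => (⟨y, W y⟩ : TangentBundle J N)) x) :
    VectorField.mlieBracket J V (fun y => f y • W y) x =
      dirD f (V x) • W x + f x • VectorField.mlieBracket J V W x := by
  have : IsManifold J 2 N := IsManifold.of_le (n := ∞) (WithTop.coe_le_coe.2 le_top)
  exact VectorField.mlieBracket_smul_right hf hW

/-- The Lie bracket acts on functions as the commutator. -/
theorem dirD_mlieBracket (V W : Cₛ^∞⟮J; EN, (TangentSpace J : N → Type _)⟯) {f : N → ℝ} {x : N}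
    (hf : ContMDiffAt J 𝓘(ℝ, ℝ) ∞ f x) :
    dirD f (VectorField.mlieBracket J V W x) =
      dirD (fun y => dirD f (W y)) (V x) - dirD (fun y => dirD f (V y)) (W x) := by
  -- The argument compares coefficients of a field `U` that is nonzero at `x`, so the
  -- zero-dimensional model is treated apart.
  by_cases hE : Subsingleton EN
  · have h0 : ∀ (r : N → ℝ) (v : TangentSpace J x), dirD r v = 0 := by
      intro r v
      have : v = 0 := @Subsingleton.elim EN hE v 0
      rw [this, dirD_zero_right]
    rw [h0, h0, h0, sub_zero]
  rw [not_subsingleton_iff_nontrivial] at hE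
  have hle : ∀ k : ℕ, minSmoothness ℝ (k : WithTop ℕ∞) ≤ ∞ := fun k => by
    rw [minSmoothness_of_isRCLikeNormedField]
    exact WithTop.coe_le_coe.2 (le_top : (k : ℕ∞) ≤ ⊤)
  have : IsManifold J (minSmoothness ℝ 3) N := IsManifold.of_le (n := ∞) (hle 3)
  have : IsManifold J 2 N := IsManifold.of_le (n := ∞) (WithTop.coe_le_coe.2 le_top)
  obtain ⟨u, hu⟩ := exists_ne (0 : EN)
  set U : ∀ y : N, TangentSpace J y :=
    FiberBundle.extend EN (E := (TangentSpace J : N → Type _)) (x := x) u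
  have hUx : U x = u := FiberBundle.extend_apply_self EN (E := (TangentSpace J : N → Type _)) _
  have sU : SmoothFieldAt U x :=
    FiberBundle.contMDiffAt_extend J EN (V := (TangentSpace J : N → Type _)) (x := x) u
  have hf' := eventually_mdifferentiableAt hf
  have expand : ∀ A B : Cₛ^∞⟮J; EN, (TangentSpace J : N → Type _)⟯,
      VectorField.mlieBracket J A (VectorField.mlieBracket J B (fun y => f y • U y)) x =
        dirD (fun y => dirD f (B y)) (A x) • U x +
        dirD f (B x) • VectorField.mlieBracket J A U x +
        (dirD f (A x) • VectorField.mlieBracket J B U x +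
          f x • VectorField.mlieBracket J A (VectorField.mlieBracket J B U) x) := by
    intro A B
    have sB := SmoothFieldAt.mlieBracket (B.contMDiff x) sU
    have hBf := contMDiffAt_dirD B hf
    -- The inner bracket is differentiated again, so its Leibniz expansion is needed on a
    -- neighbourhood of `x` and not only at `x`.
    have h1 : VectorField.mlieBracket J B (fun y => f y • U y) =ᶠ[nhds x]
        ((fun y => dirD f (B y) • U y) + fun y => f y • VectorField.mlieBracket J B U y) := by
      filter_upwards [hf', sU.mdiff] with y h1 h2 using mlieBracket_smul B h1 h2
    refine (Filter.EventuallyEq.mlieBracket_vectorField_eq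
      (Filter.EventuallyEq.refl _ (A : ∀ y : N, TangentSpace J y)) h1).trans ?_
    rw [VectorField.mlieBracket_add_right (sU.smul hBf).mdiff.self_of_nhds
        (sB.smul hf).mdiff.self_of_nhds,
      mlieBracket_smul _ hf'.self_of_nhds sB.mdiff.self_of_nhds,
      mlieBracket_smul _ (hBf.mdifferentiableAt (by simp)) sU.mdiff.self_of_nhds]
  have jac := fun (T : ∀ y : N, TangentSpace J y) (hT : SmoothFieldAt T x) =>
    VectorField.leibniz_identity_mlieBracket_apply (I := J) (x := x)
      ((V.contMDiff x).of_le (hle 2)) ((W.contMDiff x).of_le (hle 2))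
      (ContMDiffAt.of_le hT (hle 2))
  -- The Jacobi identity for `V, W, fU`: the mixed terms `(Vf)[W,U]` and `(Wf)[V,U]` occur on both
  -- sides, the terms with factor `f` cancel by Jacobi for `V, W, U`, and only multiples of `U`
  -- remain.
  have j1 := jac _ (sU.smul hf)
  rw [expand, expand, mlieBracket_smul _ hf'.self_of_nhds sU.mdiff.self_of_nhds,
    jac U sU] at j1
  have j2 : (dirD (fun y => dirD f (W y)) (V x) - dirD (fun y => dirD f (V y)) (W x) -
      dirD f (VectorField.mlieBracket J V W x)) • U x = 0 := by
    rw [sub_smul, sub_smul, sub_sub, sub_eq_zero]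
    rw [smul_add] at j1
    have j3 := sub_eq_zero.2 j1
    rw [← sub_eq_zero, ← j3]
    abel
  rcases smul_eq_zero.1 j2 with h | h
  · linarith
  · exact absurd (hUx.symm.trans h) hu

end Bracket

/-! ### Global fields and functions from local ones -/

section Globalization

variable {EN HN N : Type*} [NormedAddCommGroup EN] [NormedSpace ℝ EN] [TopologicalSpace HN]
  {J : ModelWithCorners ℝ EN HN} [TopologicalSpace N] [ChartedSpace HN N] [IsManifold J ∞ N]
  [FiniteDimensional ℝ EN] [T2Space N]

variable (J) in
/-- Every germ of the local extension of a tangent vector is the germ of a global vector field. -/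
theorem exists_field_eventually_eq_extend {q : N} (v : TangentSpace J q) :
    ∃ Z : Cₛ^∞⟮J; EN, (TangentSpace J : N → Type _)⟯, ∀ᶠ x in nhds q,
      Z x = FiberBundle.extend EN (E := (TangentSpace J : N → Type _)) v x := by
  obtain ⟨s, hs, h⟩ := FiberBundle.exists_contMDiffOn_extend (k := ∞) J EN
    (V := (TangentSpace J : N → Type _)) v
  obtain ⟨u, hus, huo, hqu⟩ := mem_nhds_iff.1 hs
  -- The closed support of the bump function lies in the open set where the local extension is
  -- smooth, so the product is smooth everywhere.
  obtain ⟨ρ, hρ, -⟩ := (SmoothBumpFunction.nhds_basis_support (I := J)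
    (huo.mem_nhds hqu)).mem_iff.1 (huo.mem_nhds hqu)
  refine ⟨⟨fun x => ρ x • FiberBundle.extend EN (E := (TangentSpace J : N → Type _)) v x,
    ContMDiffOn.smul_section_of_tsupport ρ.contMDiff.contMDiffOn huo hρ (h.mono hus)⟩, ?_⟩
  filter_upwards [ρ.eventuallyEq_one] with x hx
  change ρ x • FiberBundle.extend EN (E := (TangentSpace J : N → Type _)) v x = _
  rw [hx, Pi.one_apply, one_smul]

variable (J) in
theorem exists_field_eq {q : N} (v : TangentSpace J q) :
    ∃ Z : Cₛ^∞⟮J; EN, (TangentSpace J : N → Type _)⟯, Z q = v := by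
  obtain ⟨Z, hZ⟩ := exists_field_eventually_eq_extend J v
  exact ⟨Z, hZ.self_of_nhds.trans (FiberBundle.extend_apply_self EN v)⟩

/-- The differentials of global smooth functions separate tangent vectors. -/
theorem eq_zero_of_forall_dirD {q : N} {v : TangentSpace J q}
    (h : ∀ g : C^∞⟮J, N; 𝓘(ℝ, ℝ), ℝ⟯, dirD g v = 0) : v = 0 := by
  obtain ⟨e, he⟩ := isInvertible_mfderiv_extChartAt (mem_extChartAt_source (I := J) q)
  apply e.injective
  rw [ContinuousLinearEquiv.map_zero]
  by_contra hne
  -- A linear functional of the chart, cut off by a bump function, is a global function whose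
  -- differential does not kill `v`.
  obtain ⟨L, hL⟩ : ∃ L : EN →L[ℝ] ℝ, L (e v) ≠ 0 := SeparatingDual.exists_ne_zero hne
  obtain ⟨ρ⟩ : Nonempty (SmoothBumpFunction J q) := inferInstance
  have hφ : ContMDiffOn J 𝓘(ℝ, ℝ) ∞ (fun x => L (extChartAt J q x)) (chartAt HN q).source :=
    L.contMDiff.comp_contMDiffOn contMDiffOn_extChartAt
  have hg := h ⟨_, ρ.contMDiff_smul hφ⟩
  have h1 : (fun x => ρ x • L (extChartAt J q x)) =ᶠ[nhds q] fun x => L (extChartAt J q x) := by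
    filter_upwards [ρ.eventuallyEq_one] with x hx
    rw [hx, Pi.one_apply, one_smul]
  have h2 : dirD (fun x => L (extChartAt J q x)) v = 0 := (dirD_congr h1 v).symm.trans hg
  have h3 := mfderiv_comp (I := J) (I' := 𝓘(ℝ, EN)) (I'' := 𝓘(ℝ, ℝ)) q (g := L)
    (f := extChartAt J q) L.mdifferentiableAt
    (mdifferentiableAt_extChartAt (mem_chart_source HN q))
  rw [ContinuousLinearMap.mfderiv_eq, ← he] at h3
  exact hL ((DFunLike.congr_fun h3 v).symm.trans h2)

end Globalization

/-! ### Fibrewise linear functions on the cotangent bundle -/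

section Ell

variable {n : ℕ} {M : Type*} [TopologicalSpace M] [ChartedSpace (EuclideanSpace ℝ (Fin n)) M]
  [IsManifold (𝓡 n) ∞ M]

/-- The fibrewise linear function on `T*M` defined by a (not necessarily smooth) vector field. -/
noncomputable def ellFun (Z : ∀ x : M, TangentSpace (𝓡 n) x) (ζ : Cotangent n M) : ℝ :=
  ζ.snd (Z ζ.proj)

theorem contMDiff_proj : ContMDiff (coI n) (𝓡 n) ∞ (Bundle.TotalSpace.proj : Cotangent n M → M) :=
  Bundle.contMDiff_proj (CotangentSpace n M)

theorem contMDiffAt_ellFun {Z : ∀ x : M, TangentSpace (𝓡 n) x} {ξ : Cotangent n M}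
    (hZ : SmoothFieldAt Z ξ.proj) : ContMDiffAt (coI n) 𝓘(ℝ, ℝ) ∞ (ellFun Z) ξ := by
  have h1 := ContMDiffAt.clm_bundle_apply (IB := 𝓡 n) (IM := coI n) (n := ∞)
    (E₁ := (TangentSpace (𝓡 n) : M → Type _)) (E₂ := Bundle.Trivial M ℝ) (F₂ := ℝ)
    (b := fun ζ : Cotangent n M => ζ.proj) (ϕ := fun ζ => ζ.snd) (v := fun ζ => Z ζ.proj) (x := ξ)
    contMDiffAt_id (ContMDiffAt.comp ξ hZ contMDiff_proj.contMDiffAt)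
  exact (Bundle.contMDiffAt_totalSpace.1 h1).2

/-- Needed beside the smooth version because `TensorialAt` quantifies over sections that are merely
differentiable at the point. -/
theorem mdifferentiableAt_ellFun {Z : ∀ x : M, TangentSpace (𝓡 n) x} {ξ : Cotangent n M}
    (hZ : MDifferentiableAt (𝓡 n) ((𝓡 n).prod 𝓘(ℝ, EuclideanSpace ℝ (Fin n)))
      (fun y => (⟨y, Z y⟩ : TangentBundle (𝓡 n) M)) ξ.proj) :
    MDifferentiableAt (coI n) 𝓘(ℝ, ℝ) (ellFun Z) ξ := by
  have h1 := MDifferentiableAt.clm_bundle_apply (IB := 𝓡 n) (IM := coI n)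
    (E₁ := (TangentSpace (𝓡 n) : M → Type _)) (E₂ := Bundle.Trivial M ℝ) (F₂ := ℝ)
    (b := fun ζ : Cotangent n M => ζ.proj) (ϕ := fun ζ => ζ.snd) (v := fun ζ => Z ζ.proj) (x := ξ)
    mdifferentiableAt_id
    (MDifferentiableAt.comp ξ hZ (contMDiff_proj.mdifferentiableAt (by simp)))
  exact ((mdifferentiableAt_totalSpace _ _).1 h1).2

/-- The fibrewise linear function on `T*M` defined by a smooth vector field. -/
noncomputable def ell (Z : VectorFields n M) : CoFunctions n M :=
  ⟨ellFun Z, fun ξ => contMDiffAt_ellFun (Z.contMDiff ξ.proj)⟩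

theorem dirD_ellFun_vlift {Z : ∀ x : M, TangentSpace (𝓡 n) x} {ξ : Cotangent n M}
    (hZ : MDifferentiableAt (coI n) 𝓘(ℝ, ℝ) (ellFun Z) ξ) (η : CoModel n) :
    dirD (ellFun Z) (vlift ξ η) = η (Z ξ.proj) := by
  have h := mfderiv_comp (I := 𝓘(ℝ, CoModel n)) (I' := coI n) (I'' := 𝓘(ℝ, ℝ))
    (fibPt ξ) (g := ellFun Z) (f := fiberIncl (n := n) ξ.proj) hZ
    ((contMDiff_fiberIncl ξ.proj).mdifferentiableAt (by simp))
  rw [mfderiv_eq_fderiv] at h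
  refine (DFunLike.congr_fun h η).symm.trans ?_
  let u : EuclideanSpace ℝ (Fin n) := Z ξ.proj
  exact DFunLike.congr_fun
    (ContinuousLinearMap.fderiv (ContinuousLinearMap.apply ℝ ℝ u : CoModel n →L[ℝ] ℝ)) η

theorem dirD_comp_proj {g : M → ℝ} {ξ : Cotangent n M}
    (hg : MDifferentiableAt (𝓡 n) 𝓘(ℝ, ℝ) g ξ.proj) (v : TangentSpace (coI n) ξ) :
    dirD (fun ζ : Cotangent n M => g ζ.proj) v =
      dirD g (mfderiv (coI n) (𝓡 n) (Bundle.TotalSpace.proj : Cotangent n M → M) ξ v) :=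
  DFunLike.congr_fun (mfderiv_comp (I := coI n) (I' := 𝓡 n) (I'' := 𝓘(ℝ, ℝ)) ξ hg
    (contMDiff_proj.mdifferentiableAt (by simp))) v

/-- The cotangent bundle is a bundle of homomorphisms, so its trivialization is precomposition with
the inverse of the tangent one. -/
theorem fibCoord_apply {q : M} {ξ : Cotangent n M} (h : ξ.proj ∈ (trivializationAt
    (EuclideanSpace ℝ (Fin n)) (TangentSpace (𝓡 n) : M → Type _) q).baseSet)
    (e : EuclideanSpace ℝ (Fin n)) :
    fibCoord q ξ e = ξ.snd ((trivializationAt (EuclideanSpace ℝ (Fin n))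
      (TangentSpace (𝓡 n) : M → Type _) q).symm ξ.proj e) := by
  change (trivializationAt ℝ (Bundle.Trivial M ℝ) q).continuousLinearMapAt ℝ ξ.proj
    (ξ.snd ((trivializationAt (EuclideanSpace ℝ (Fin n))
      (TangentSpace (𝓡 n) : M → Type _) q).symmL ℝ ξ.proj e)) = _
  rw [Bundle.Trivialization.symmL_apply]
  · simp
  · exact h

/-- Fibre coordinates on `T*M` are locally given by global fibrewise linear functions. -/
theorem exists_ell_eq_fibCoord [T2Space M] (q : M) (e : EuclideanSpace ℝ (Fin n)) :
    ∃ Z : VectorFields n M, ∀ᶠ x in nhds q, ∀ ξ : Cotangent n M, ξ.proj = x →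
      ell Z ξ = fibCoord q ξ e := by
  set t := trivializationAt (EuclideanSpace ℝ (Fin n)) (TangentSpace (𝓡 n) : M → Type _) q
  have hq : q ∈ t.baseSet := FiberBundle.mem_baseSet_trivializationAt' q
  -- Near `q` this field has the constant coordinate vector `e` in the trivialization `t`.
  obtain ⟨Z, hZ⟩ := exists_field_eventually_eq_extend (𝓡 n) (q := q) (t.symm q e)
  refine ⟨Z, ?_⟩
  filter_upwards [hZ, t.open_baseSet.mem_nhds hq] with x hx hxt ξ hξ
  subst hξ
  rw [fibCoord_apply hxt]
  change ξ.snd (Z ξ.proj) = _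
  rw [hx, FiberBundle.extend, t.apply_mk_symm hq]

/-- In bundle charts the projection is the first coordinate projection. -/
theorem proj_surjective (ξ : Cotangent n M) : Function.Surjective
    (mfderiv (coI n) (𝓡 n) (Bundle.TotalSpace.proj : Cotangent n M → M) ξ) := by
  intro u
  obtain ⟨e, he⟩ := isInvertible_mfderiv_extChartAt (mem_extChartAt_source (I := coI n) ξ)
  obtain ⟨e', he'⟩ := isInvertible_mfderiv_extChartAt (mem_extChartAt_source (I := 𝓡 n) ξ.proj)
  obtain ⟨v, hv⟩ := e.surjective ((e' u, 0) : EuclideanSpace ℝ (Fin n) × CoModel n)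
  refine ⟨v, e'.injective ?_⟩
  have h := mfderiv_extChartAt_eq (mem_chart_source (EuclideanSpace ℝ (Fin n)) ξ.proj) v
  have h2 := (DFunLike.congr_fun he v).symm.trans hv
  have h3 := congrArg Prod.fst (h.symm.trans h2)
  exact (DFunLike.congr_fun he' _).trans h3

end Ell

/-! ### Existence, uniqueness and smoothness of the cotangent lift -/

section Lift

variable {n : ℕ} {M : Type*} [TopologicalSpace M] [ChartedSpace (EuclideanSpace ℝ (Fin n)) M]
  [IsManifold (𝓡 n) ∞ M]

/-- The obstruction for a tangent vector `v` of `T*M` over `X` to be the value of the cotangent lift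
of `X`. It is tensorial. -/
noncomputable def liftDefect (X : VectorFields n M) {ξ : Cotangent n M}
    (v : TangentSpace (coI n) ξ) (W : ∀ x : M, TangentSpace (𝓡 n) x) : ℝ :=
  dirD (ellFun W) v - ξ.snd (VectorField.mlieBracket (𝓡 n) X W ξ.proj)

/-- Passing from `W` to `fW` adds `(X f) ℓ_W(ξ)` to both terms of the defect: to the first because
`v` projects to `X`, to the second by the Leibniz rule for the bracket. The two additions cancel. -/
theorem tensorialAt_liftDefect (X : VectorFields n M) {ξ : Cotangent n M}
    {v : TangentSpace (coI n) ξ}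
    (hv : mfderiv (coI n) (𝓡 n) (Bundle.TotalSpace.proj : Cotangent n M → M) ξ v = X ξ.proj) :
    TensorialAt (𝓡 n) (EuclideanSpace ℝ (Fin n)) (liftDefect X v) ξ.proj where
  smul {f W} hf hW := by
    have h1 := dirD_mul (f := fun ζ : Cotangent n M => f ζ.proj)
      (MDifferentiableAt.comp ξ hf (contMDiff_proj.mdifferentiableAt (by simp)))
      (mdifferentiableAt_ellFun hW) v
    rw [dirD_comp_proj hf, hv] at h1
    have h2 : (fun ζ : Cotangent n M => f ζ.proj * ellFun W ζ) = ellFun (f • W) := by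
      funext ζ
      exact (ζ.snd.map_smul (f ζ.proj) (W ζ.proj)).symm
    rw [h2] at h1
    have h3 : VectorField.mlieBracket (𝓡 n) X (f • W) ξ.proj = _ := mlieBracket_smul X hf hW
    rw [liftDefect, h1, h3]
    have h4 : (ξ.snd (dirD f (X ξ.proj) • W ξ.proj +
        f ξ.proj • VectorField.mlieBracket (𝓡 n) X W ξ.proj) : ℝ) =
        dirD f (X ξ.proj) * ellFun W ξ +
          f ξ.proj * (ξ.snd (VectorField.mlieBracket (𝓡 n) X W ξ.proj) : ℝ) :=
      (ξ.snd.map_add _ _).trans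
        (congrArg₂ (fun a b : ℝ => a + b) (ξ.snd.map_smul _ _) (ξ.snd.map_smul _ _))
    refine (congrArg (fun z : ℝ => f ξ.proj * dirD (ellFun W) v +
      dirD f (X ξ.proj) * ellFun W ξ - z) h4).trans ?_
    change _ = f ξ.proj * (dirD (ellFun W) v -
      (ξ.snd (VectorField.mlieBracket (𝓡 n) X W ξ.proj) : ℝ))
    ring
  add {W W'} hW hW' := by
    have : IsManifold (𝓡 n) 2 M := IsManifold.of_le (n := ∞) (WithTop.coe_le_coe.2 le_top)
    have h1 := dirD_add (mdifferentiableAt_ellFun hW) (mdifferentiableAt_ellFun hW') v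
    have h2 : (fun ζ : Cotangent n M => ellFun W ζ + ellFun W' ζ) = ellFun (W + W') := by
      funext ζ
      exact (ζ.snd.map_add (W ζ.proj) (W' ζ.proj)).symm
    rw [h2] at h1
    rw [liftDefect, h1, VectorField.mlieBracket_add_right hW hW']
    have h4 := ξ.snd.map_add (VectorField.mlieBracket (𝓡 n) X W ξ.proj)
      (VectorField.mlieBracket (𝓡 n) X W' ξ.proj)
    refine (congrArg (fun z : ℝ => dirD (ellFun W) v + dirD (ellFun W') v - z) h4).trans ?_
    exact add_sub_add_comm _ _ _ _

/-- `v` is the value at `ξ` of the cotangent lift of `X`. -/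
def IsLiftAt (X : VectorFields n M) {ξ : Cotangent n M} (v : TangentSpace (coI n) ξ) : Prop :=
  mfderiv (coI n) (𝓡 n) (Bundle.TotalSpace.proj : Cotangent n M → M) ξ v = X ξ.proj ∧
  ∀ Z : VectorFields n M, dirD (ell Z) v = ell (bracket X Z) ξ

theorem isCotangentLift_iff {X : VectorFields n M} {Y : CoVectorFields n M} :
    IsCotangentLift X Y ↔ ∀ ξ, IsLiftAt X (Y ξ) :=
  ⟨fun h ξ => ⟨h.1 ξ, fun Z => h.2 Z ξ⟩, fun h => ⟨fun ξ => (h ξ).1, fun Z ξ => (h ξ).2 Z⟩⟩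

/-- Tensoriality turns the defect of an arbitrary vector over `X` into a covector `η`. A vertical
lift acts on `ℓ_Z` as evaluation at `Z`, so subtracting `vlift ξ η` removes the defect and leaves
the projection unchanged. -/
theorem exists_isLiftAt (X : VectorFields n M) (ξ : Cotangent n M) :
    ∃ v : TangentSpace (coI n) ξ, IsLiftAt X v := by
  obtain ⟨v, hv⟩ := proj_surjective ξ (X ξ.proj)
  have hT := tensorialAt_liftDefect X hv
  let η : CoModel n := TensorialAt.mkHom (liftDefect X v) ξ.proj hT
  refine ⟨v - vlift ξ η, ?_, fun Z => ?_⟩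
  · rw [ContinuousLinearMap.map_sub, mfderiv_proj_vlift, hv, sub_zero]
  · have h1 : η (Z ξ.proj) = liftDefect X v Z :=
      TensorialAt.mkHom_apply hT (Z.mdifferentiableAt)
    have h2 : dirD (ell Z) (vlift ξ η) = η (Z ξ.proj) :=
      dirD_ellFun_vlift (mdifferentiableAt_ellFun Z.mdifferentiableAt) η
    rw [dirD_sub_right, h2, h1]
    exact sub_sub_cancel _ _

/-- A vertical vector is determined by its action on fibrewise linear functions. -/
theorem eq_zero_of_forall_ell [T2Space M] {ξ : Cotangent n M} {v : TangentSpace (coI n) ξ}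
    (h1 : mfderiv (coI n) (𝓡 n) (Bundle.TotalSpace.proj : Cotangent n M → M) ξ v = 0)
    (h2 : ∀ Z : VectorFields n M, dirD (ell Z) v = 0) : v = 0 := by
  obtain ⟨η, rfl⟩ := exists_vlift_of_vertical h1
  have h0 : η = 0 := by
    ext u
    obtain ⟨Z, hZ⟩ := exists_field_eq (𝓡 n) (q := ξ.proj) u
    have h : dirD (ell Z) (vlift ξ η) = η (Z ξ.proj) :=
      dirD_ellFun_vlift (mdifferentiableAt_ellFun Z.mdifferentiableAt) η
    rw [h2, hZ] at h
    exact h.symm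
  rw [h0, ContinuousLinearMap.map_zero]

theorem IsLiftAt.unique [T2Space M] {X : VectorFields n M} {ξ : Cotangent n M}
    {v w : TangentSpace (coI n) ξ} (hv : IsLiftAt X v) (hw : IsLiftAt X w) : v = w := by
  refine sub_eq_zero.1 (eq_zero_of_forall_ell ?_ fun Z => ?_)
  · rw [ContinuousLinearMap.map_sub, hv.1, hw.1, sub_self]
  · rw [dirD_sub_right, hv.2, hw.2, sub_self]

/-- Expansion in the dual of the standard basis. -/
theorem contMDiffAt_coModel {c : Cotangent n M → CoModel n} {ξ : Cotangent n M}
    (h : ∀ e, ContMDiffAt (coI n) 𝓘(ℝ, ℝ) ∞ (fun ζ => c ζ e) ξ) :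
    ContMDiffAt (coI n) 𝓘(ℝ, CoModel n) ∞ c ξ := by
  have h1 : c = fun ζ => ∑ i, c ζ (EuclideanSpace.single i 1) •
      (EuclideanSpace.proj i : CoModel n) := by
    funext ζ
    ext e
    conv_lhs => rw [← (EuclideanSpace.basisFun (Fin n) ℝ).sum_repr e, map_sum]
    simp [mul_comm]
  rw [h1]
  exact contMDiffAt_finsetSum fun i _ => (h _).smul contMDiffAt_const

/-- The pointwise lifts are chosen without regard to smoothness. It is read off in a bundle chart:
the base component is that of `X`, and the fibre component, evaluated on `e`, is locally some
`ℓ_{[X,Z]}`. -/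
theorem contMDiff_of_isLiftAt [T2Space M] {X : VectorFields n M}
    {Y : ∀ ξ : Cotangent n M, TangentSpace (coI n) ξ} (hY : ∀ ξ, IsLiftAt X (Y ξ)) :
    ContMDiff (coI n) ((coI n).prod 𝓘(ℝ, EuclideanSpace ℝ (Fin n) × CoModel n)) ∞
      (fun ξ => (⟨ξ, Y ξ⟩ : TangentBundle (coI n) (Cotangent n M))) := by
  intro ξ₀
  rw [Bundle.contMDiffAt_section]
  have hb : ξ₀.proj ∈ (trivializationAt (CoModel n) (CotangentSpace n M) ξ₀.proj).baseSet :=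
    FiberBundle.mem_baseSet_trivializationAt' _
  have hA : ContMDiffAt (coI n) 𝓘(ℝ, EuclideanSpace ℝ (Fin n)) ∞ (fun ξ : Cotangent n M =>
      (mfderiv (𝓡 n) 𝓘(ℝ, EuclideanSpace ℝ (Fin n)) (extChartAt (𝓡 n) ξ₀.proj) ξ.proj
        (X ξ.proj) : EuclideanSpace ℝ (Fin n))) ξ₀ :=
    ContMDiffAt.comp ξ₀ (contMDiffAt_dirDeriv X contMDiffAt_extChartAt) contMDiff_proj.contMDiffAt
  have hB : ContMDiffAt (coI n) 𝓘(ℝ, CoModel n) ∞ (fun ξ : Cotangent n M =>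
      (mfderiv (coI n) 𝓘(ℝ, CoModel n) (fibCoord ξ₀.proj) ξ (Y ξ) : CoModel n)) ξ₀ := by
    refine contMDiffAt_coModel fun e => ?_
    obtain ⟨Z, hZ⟩ := exists_ell_eq_fibCoord ξ₀.proj e
    have hZ' : ∀ᶠ ξ : Cotangent n M in nhds ξ₀, ell Z ξ = fibCoord ξ₀.proj ξ e := by
      filter_upwards [contMDiff_proj.continuous.continuousAt.eventually hZ] with ξ hξ
      exact hξ ξ rfl
    refine ((ell (bracket X Z)).contMDiff ξ₀).congr_of_eventuallyEq ?_
    -- Derivatives at each nearby `ξ` are compared, so the two functions must agree on a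
    -- neighbourhood of each such `ξ`.
    filter_upwards [hZ'.eventually_nhds, eventually_baseSet ξ₀.proj hb] with ξ h1 h2
    rw [← (hY ξ).2 Z, dirD_congr h1]
    have h3 := mfderiv_comp (I := coI n) (I' := 𝓘(ℝ, CoModel n)) (I'' := 𝓘(ℝ, ℝ)) ξ
      (g := ContinuousLinearMap.apply ℝ ℝ e) (f := fibCoord ξ₀.proj)
      (ContinuousLinearMap.apply ℝ ℝ e).mdifferentiableAt
      ((contMDiffAt_fibCoord h2).mdifferentiableAt (by simp))
    rw [ContinuousLinearMap.mfderiv_eq] at h3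
    exact (DFunLike.congr_fun h3 (Y ξ)).symm
  refine (ContMDiffAt.prodMk_space hA hB).congr_of_eventuallyEq ?_
  have hs' := (chartAt (ModelProd (EuclideanSpace ℝ (Fin n)) (CoModel n)) ξ₀).open_source.mem_nhds
    (mem_chart_source _ _)
  filter_upwards [eventually_baseSet ξ₀.proj hb, hs'] with ξ h1 h'
  have h : ξ.proj ∈ (chartAt (EuclideanSpace ℝ (Fin n)) ξ₀.proj).source := by simpa using h1
  have h3 := DFunLike.congr_fun
    (TangentBundle.continuousLinearMapAt_trivializationAt (I := coI n) h') (Y ξ)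
  have h4 := mfderiv_extChartAt_eq h (Y ξ)
  rw [(hY ξ).1] at h4
  have h5 := h3.trans h4
  rw [Bundle.Trivialization.continuousLinearMapAt_apply,
    Bundle.Trivialization.coe_linearMapAt_of_mem] at h5
  · exact h5
  · exact h'

theorem existsUnique_isCotangentLift [T2Space M] (X : VectorFields n M) :
    ∃! Y : CoVectorFields n M, IsCotangentLift X Y := by
  choose Y hY using exists_isLiftAt X
  refine ⟨⟨Y, contMDiff_of_isLiftAt hY⟩, isCotangentLift_iff.2 hY, fun Y' hY' => ?_⟩
  exact ContMDiffSection.ext fun ξ => (isCotangentLift_iff.1 hY' ξ).unique (hY ξ)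

end Lift

/-! ### Lie derivatives along cotangent lifts are derivations of the algebra -/

section LieDerivative

variable {n : ℕ} {M : Type*} [TopologicalSpace M] [ChartedSpace (EuclideanSpace ℝ (Fin n)) M]
  [IsManifold (𝓡 n) ∞ M]

theorem lieFun_bracket (Y Y' : CoVectorFields n M) (f : CoFunctions n M) :
    lieFun (bracket Y Y') f = lieFun Y (lieFun Y' f) - lieFun Y' (lieFun Y f) :=
  ContMDiffMap.ext fun ξ => dirD_mlieBracket Y Y' (f.contMDiff ξ)

theorem lieFun_ell {X : VectorFields n M} {Y : CoVectorFields n M} (hY : IsCotangentLift X Y)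
    (Z : VectorFields n M) : lieFun Y (ell Z) = ell (bracket X Z) :=
  ContMDiffMap.ext fun ξ => hY.2 Z ξ

theorem lieFun_vertical_ell (s : VerticalFields n M) (Z : VectorFields n M) (q : M)
    (p : CoModel n) :
    lieFun (s : CoVectorFields n M) (ell Z) (fiberIncl q p) = vfib s q p (Z q) := by
  have h := dirD_ellFun_vlift (ξ := fiberIncl q p)
    (mdifferentiableAt_ellFun (Z := Z) Z.mdifferentiableAt) (vcomp s (fiberIncl q p))
  rw [vlift_vcomp] at h
  exact h

/-- On a fibre, `t ℓ_Z` is the fibre component of `t` followed by the fixed linear map evaluating at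
`Z q`, and differentiation commutes with that map. For general functions a second derivative would
appear. -/
theorem lieFun_mul_ell (s t : VerticalFields n M) (Z : VectorFields n M) :
    lieFun (↑(s * t)) (ell Z) = lieFun (s : CoVectorFields n M) (lieFun t (ell Z)) :=
  ContMDiffMap.ext fun ξ => by
    have h1 := lieFun_vertical_ell (s * t) Z ξ.proj (fibPt ξ)
    have h2 := lieFun_vertical s (lieFun (t : CoVectorFields n M) (ell Z)) ξ.proj (fibPt ξ)
    simp only [lieFun_vertical_ell] at h2
    let u : EuclideanSpace ℝ (Fin n) := Z ξ.proj
    have h3 := ((ContinuousLinearMap.apply ℝ ℝ u : CoModel n →L[ℝ] ℝ).hasFDerivAt.comp _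
      (differentiable_vfib t ξ.proj (fibPt ξ)).hasFDerivAt).fderiv
    rw [vfib_mul] at h1
    exact h1.trans ((DFunLike.congr_fun h3 (vfib s ξ.proj (fibPt ξ))).symm.trans h2.symm)

theorem vertical_ext_ell [T2Space M] {s t : VerticalFields n M}
    (h : ∀ Z : VectorFields n M, lieFun (s : CoVectorFields n M) (ell Z) = lieFun t (ell Z)) :
    s = t := by
  refine Subtype.ext (ContMDiffSection.ext fun ξ => sub_eq_zero.1 (eq_zero_of_forall_ell ?_
    fun Z => ?_))
  · rw [ContinuousLinearMap.map_sub, s.2 ξ, t.2 ξ, sub_self]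
  · rw [dirD_sub_right, sub_eq_zero]
    exact DFunLike.congr_fun (h Z) ξ

/-- On a pulled-back function, `s (g ∘ p) = 0`, and `Y (g ∘ p) = (X g) ∘ p` is again pulled back, so
both terms of the commutator vanish. -/
theorem bracket_mem_vertical [T2Space M] {X : VectorFields n M} {Y : CoVectorFields n M}
    (hY : IsCotangentLift X Y) (s : VerticalFields n M) :
    bracket Y (s : CoVectorFields n M) ∈ verticalSubmodule n M := by
  intro ξ
  refine eq_zero_of_forall_dirD fun g => ?_
  have hg : ∀ q, MDifferentiableAt (𝓡 n) 𝓘(ℝ, ℝ) g q := fun q => g.mdifferentiableAt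
  rw [← dirD_comp_proj (hg _)]
  have hXg : ContMDiff (𝓡 n) 𝓘(ℝ, ℝ) ∞ (fun q => dirD g (X q)) := fun q =>
    contMDiffAt_dirD X (g.contMDiff q)
  refine (dirD_mlieBracket Y (s : CoVectorFields n M)
    (ContMDiffAt.comp ξ (g.contMDiff ξ.proj) contMDiff_proj.contMDiffAt)).trans ?_
  have h1 : (fun ζ : Cotangent n M => dirD (⇑g ∘ Bundle.TotalSpace.proj)
      ((s : CoVectorFields n M) ζ)) = fun _ => 0 := by
    funext ζ
    refine (dirD_comp_proj (hg _) _).trans ?_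
    rw [s.2 ζ, dirD_zero_right]
  have h2 : (fun ζ : Cotangent n M => dirD (⇑g ∘ Bundle.TotalSpace.proj) (Y ζ)) =
      fun ζ => dirD g (X ζ.proj) := by
    funext ζ
    refine (dirD_comp_proj (hg _) _).trans ?_
    rw [hY.1 ζ]
  rw [h1, h2, dirD_const, dirD_comp_proj (hXg.mdifferentiable (by simp) _), s.2 ξ,
    dirD_zero_right, sub_zero]

/-- The Lie derivative of vertical fields along a cotangent lift. -/
noncomputable def lieVertical [T2Space M] {X : VectorFields n M} {Y : CoVectorFields n M}
    (hY : IsCotangentLift X Y) (s : VerticalFields n M) : VerticalFields n M :=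
  ⟨bracket Y s, bracket_mem_vertical hY s⟩

theorem lieFun_sub_right (Y : CoVectorFields n M) (f g : CoFunctions n M) :
    lieFun Y (f - g) = lieFun Y f - lieFun Y g := by
  rw [eq_sub_iff_add_eq, ← lieFun_add_right, sub_add_cancel]

/-- Tested on `ℓ_Z`, products become composites and the right side telescopes: `(Ys - sY)t + s(Yt -
tY) = Yst - stY`. Composites may be used for `Y ℓ_Z` too, since it is `ℓ_{[X,Z]}`. -/
theorem lieVertical_mul [T2Space M] {X : VectorFields n M} {Y : CoVectorFields n M}
    (hY : IsCotangentLift X Y) (s t : VerticalFields n M) :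
    lieVertical hY (s * t) = lieVertical hY s * t + s * lieVertical hY t := by
  refine vertical_ext_ell fun Z => ?_
  change lieFun (bracket Y (↑(s * t))) (ell Z) =
    lieFun (↑(lieVertical hY s * t) + ↑(s * lieVertical hY t)) (ell Z)
  rw [lieFun_add_left, lieFun_mul_ell, lieFun_mul_ell, lieFun_bracket, lieFun_mul_ell,
    lieFun_ell hY, lieFun_mul_ell]
  change _ = lieFun (bracket Y s) _ + lieFun s.1 (lieFun (bracket Y t) (ell Z))
  rw [lieFun_bracket, lieFun_bracket, lieFun_ell hY, lieFun_sub_right]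
  abel

variable (n M) in
theorem isManifold_two_cotangent : IsManifold (coI n) 2 (Cotangent n M) :=
  IsManifold.of_le (n := ∞) (WithTop.coe_le_coe.2 le_top)

theorem bracket_add_right (Y s t : CoVectorFields n M) :
    bracket Y (s + t) = bracket Y s + bracket Y t := by
  have := isManifold_two_cotangent n M
  exact ContMDiffSection.ext fun ξ =>
    VectorField.mlieBracket_add_right s.mdifferentiableAt t.mdifferentiableAt

theorem bracket_smul_right (c : ℝ) (Y s : CoVectorFields n M) :
    bracket Y (c • s) = c • bracket Y s := by
  have := isManifold_two_cotangent n M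
  exact ContMDiffSection.ext fun ξ =>
    VectorField.mlieBracket_const_smul_right s.mdifferentiableAt

theorem bracket_add_left (Y Y' s : CoVectorFields n M) :
    bracket (Y + Y') s = bracket Y s + bracket Y' s := by
  have := isManifold_two_cotangent n M
  exact ContMDiffSection.ext fun ξ =>
    VectorField.mlieBracket_add_left Y.mdifferentiableAt Y'.mdifferentiableAt

theorem bracket_smul_left (c : ℝ) (Y s : CoVectorFields n M) :
    bracket (c • Y) s = c • bracket Y s := by
  have := isManifold_two_cotangent n M
  exact ContMDiffSection.ext fun ξ =>
    VectorField.mlieBracket_const_smul_left Y.mdifferentiableAt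

/-- The Lie derivative along a cotangent lift, acting on `𝒢`. -/
noncomputable def lieDer [T2Space M] {X : VectorFields n M} {Y : CoVectorFields n M}
    (hY : IsCotangentLift X Y) : CoAlgebra n M →ₗ[ℝ] CoAlgebra n M where
  toFun x := (lieVertical hY x.1, lieFun Y x.2)
  map_add' x y := CoAlgebra.ext (Subtype.ext (bracket_add_right Y x.1 y.1))
    (lieFun_add_right Y x.2 y.2)
  map_smul' c x := CoAlgebra.ext (Subtype.ext (bracket_smul_right c Y x.1))
    (lieFun_smul_right c Y x.2)

theorem isLieDerivative_lieDer [T2Space M] {X : VectorFields n M} {Y : CoVectorFields n M}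
    (hY : IsCotangentLift X Y) : IsLieDerivative Y (lieDer hY) :=
  fun _ => ⟨fun _ => rfl, rfl⟩

theorem lieDer_mul [T2Space M] {X : VectorFields n M} {Y : CoVectorFields n M}
    (hY : IsCotangentLift X Y) (a b : CoAlgebra n M) :
    lieDer hY (a * b) = lieDer hY a * b + a * lieDer hY b := by
  refine CoAlgebra.ext (lieVertical_mul hY a.1 b.1) ?_
  change lieFun Y (a.2 * b.2 + lieFun a.1.1 b.2) =
    (lieFun Y a.2 * b.2 + lieFun (bracket Y a.1) b.2) +
      (a.2 * lieFun Y b.2 + lieFun a.1.1 (lieFun Y b.2))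
  rw [lieFun_add_right, lieFun_mul, lieFun_bracket]
  ring

theorem lieDer_mem_cycles1 [T2Space M] {X : VectorFields n M} {Y : CoVectorFields n M}
    (hY : IsCotangentLift X Y) : lieDer hY ∈ cycles1 ℝ (CoAlgebra n M) := by
  rw [LinearMap.mem_ker]
  ext a b : 2
  change -((a * lieDer hY b - lieDer hY (a * b)) + lieDer hY a * b) = 0
  rw [lieDer_mul]
  abel

/-- Together with uniqueness, this and the next lemma make the lift linear in `X`. -/
theorem IsCotangentLift.add {X X' : VectorFields n M} {Y Y' : CoVectorFields n M}
    (h : IsCotangentLift X Y) (h' : IsCotangentLift X' Y') :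
    IsCotangentLift (X + X') (Y + Y') := by
  have : IsManifold (𝓡 n) 2 M := IsManifold.of_le (n := ∞) (WithTop.coe_le_coe.2 le_top)
  refine ⟨fun ξ => (ContinuousLinearMap.map_add _ (Y ξ) (Y' ξ)).trans
    (congrArg₂ _ (h.1 ξ) (h'.1 ξ)), fun Z ξ => ?_⟩
  refine (dirD_add_right (ellFun Z) (Y ξ) (Y' ξ)).trans
    ((congrArg₂ _ (h.2 Z ξ) (h'.2 Z ξ)).trans ?_)
  rw [ContMDiffSection.coe_add,
    VectorField.mlieBracket_add_left X.mdifferentiableAt X'.mdifferentiableAt]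
  exact (ξ.snd.map_add _ _).symm

theorem IsCotangentLift.smul (c : ℝ) {X : VectorFields n M} {Y : CoVectorFields n M}
    (h : IsCotangentLift X Y) : IsCotangentLift (c • X) (c • Y) := by
  have : IsManifold (𝓡 n) 2 M := IsManifold.of_le (n := ∞) (WithTop.coe_le_coe.2 le_top)
  refine ⟨fun ξ => (ContinuousLinearMap.map_smul _ c (Y ξ)).trans
    (congrArg (c • ·) (h.1 ξ)), fun Z ξ => ?_⟩
  refine ((mfderiv (coI n) 𝓘(ℝ, ℝ) (ellFun Z) ξ).map_smul c (Y ξ)).trans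
    ((congrArg (c • ·) (h.2 Z ξ)).trans ?_)
  rw [ContMDiffSection.coe_smul, VectorField.mlieBracket_const_smul_left X.mdifferentiableAt]
  exact (ξ.snd.map_smul _ _).symm

/-! ### The canonical map to homology and its injectivity -/

variable [T2Space M]

/-- The cotangent lift of a vector field. -/
noncomputable def cotangentLift (X : VectorFields n M) : CoVectorFields n M :=
  (existsUnique_isCotangentLift X).choose

theorem isCotangentLift_cotangentLift (X : VectorFields n M) :
    IsCotangentLift X (cotangentLift X) :=
  (existsUnique_isCotangentLift X).choose_spec.1

theorem IsCotangentLift.eq {X : VectorFields n M} {Y : CoVectorFields n M}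
    (h : IsCotangentLift X Y) : cotangentLift X = Y :=
  (existsUnique_isCotangentLift X).unique (isCotangentLift_cotangentLift X) h

variable (n M) in
/-- The 1-cycles given by Lie derivatives along cotangent lifts. -/
noncomputable def lieCycle : VectorFields n M →ₗ[ℝ] cycles1 ℝ (CoAlgebra n M) where
  toFun X := ⟨lieDer (isCotangentLift_cotangentLift X), lieDer_mem_cycles1 _⟩
  map_add' X X' := by
    have h := ((isCotangentLift_cotangentLift X).add (isCotangentLift_cotangentLift X')).eq
    refine Subtype.ext (LinearMap.ext fun x => CoAlgebra.ext (Subtype.ext ?_) ?_)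
    · exact (congrArg (fun Y => bracket Y x.1.1) h).trans (bracket_add_left _ _ _)
    · exact (congrArg (fun Y => lieFun Y x.2) h).trans (lieFun_add_left _ _ _)
  map_smul' c X := by
    have h := ((isCotangentLift_cotangentLift X).smul c).eq
    refine Subtype.ext (LinearMap.ext fun x => CoAlgebra.ext (Subtype.ext ?_) ?_)
    · exact (congrArg (fun Y => bracket Y x.1.1) h).trans (bracket_smul_left _ _ _)
    · exact (congrArg (fun Y => lieFun Y x.2) h).trans (lieFun_smul_left _ _ _)

variable (n M) in
/-- The canonical map from vector fields to the first homology. -/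
noncomputable def lieClass : VectorFields n M →ₗ[ℝ] CotangentH1 n M :=
  (boundaries1 ℝ (CoAlgebra n M)).mkQ ∘ₗ lieCycle n M

variable (n M) in
-- For `f = g ∘ p`, the function component of `δ₀ w` at `(0, f)` is `w.2 f + w.1 · f - f w.2`.
-- Functions commute and the vertical field `w.1` kills `f`, so it is zero; for the Lie derivative
-- it is `(X g) ∘ p`.
theorem lieClass_injective : Function.Injective (lieClass n M) := by
  rw [injective_iff_map_eq_zero]
  intro X hX
  obtain ⟨w, hw⟩ := (Submodule.Quotient.mk_eq_zero _).1 hX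
  have hw' : delta0 ℝ (CoAlgebra n M) w = lieDer (isCotangentLift_cotangentLift X) :=
    congrArg Subtype.val hw
  refine ContMDiffSection.ext fun q => eq_zero_of_forall_dirD fun g => ?_
  let f : CoFunctions n M := ⟨fun ζ => g ζ.proj, g.contMDiff.comp contMDiff_proj⟩
  have hf : ∀ (ξ : Cotangent n M) (v : TangentSpace (coI n) ξ), dirD f v =
      dirD g (mfderiv (coI n) (𝓡 n) (Bundle.TotalSpace.proj : Cotangent n M → M) ξ v) :=
    fun ξ v => dirD_comp_proj g.mdifferentiableAt v
  have h1 := congrArg Prod.snd (LinearMap.congr_fun hw' ((0, f) : CoAlgebra n M))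
  have h2 : lieFun (w.1.1 : CoVectorFields n M) f = 0 := ContMDiffMap.ext fun ξ => by
    refine (hf ξ _).trans ?_
    rw [w.1.1.2 ξ, dirD_zero_right]
    rfl
  have h3 : (w.1.2 * f + lieFun (w.1.1 : CoVectorFields n M) f) -
      (f * w.1.2 + lieFun (0 : CoVectorFields n M) w.1.2) = lieFun (cotangentLift X) f := h1
  have h4 : lieFun (0 : CoVectorFields n M) w.1.2 = 0 := by
    rw [← zero_smul ℝ (0 : CoVectorFields n M), lieFun_smul_left, zero_smul]
  rw [h2, h4, mul_comm, sub_self] at h3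
  -- Any covector over `q` would serve; the zero covector is at hand.
  have h5 := hf (fiberIncl q 0) (cotangentLift X (fiberIncl q 0))
  rw [(isCotangentLift_cotangentLift X).1] at h5
  exact h5.symm.trans (DFunLike.congr_fun h3.symm (fiberIncl q 0))

end LieDerivative

/-! ### Infinite dimension of the space of vector fields -/

section Infinite

variable {EN HN N : Type*} [NormedAddCommGroup EN] [NormedSpace ℝ EN] [TopologicalSpace HN]
  {J : ModelWithCorners ℝ EN HN} [TopologicalSpace N] [ChartedSpace HN N] [IsManifold J ∞ N]

/-- Multiplication of vector fields by a smooth function. -/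
noncomputable def funMul (f : C^∞⟮J, N; 𝓘(ℝ, ℝ), ℝ⟯) :
    Module.End ℝ Cₛ^∞⟮J; EN, (TangentSpace J : N → Type _)⟯ where
  toFun W := ⟨fun x => f x • W x, fun x => (f.contMDiff x).smul_section (W.contMDiff x)⟩
  map_add' V W := ContMDiffSection.ext fun x => smul_add (f x) (V x) (W x)
  map_smul' c W := ContMDiffSection.ext fun x => smul_comm (f x) c (W x)

open Polynomial in
theorem aeval_funMul_apply (f : C^∞⟮J, N; 𝓘(ℝ, ℝ), ℝ⟯) (P : ℝ[X])
    (W : Cₛ^∞⟮J; EN, (TangentSpace J : N → Type _)⟯) (x : N) :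
    aeval (funMul f) P W x = P.eval (f x) • W x := by
  induction P using Polynomial.induction_on' with
  | add P Q hP hQ =>
    rw [map_add, eval_add, add_smul, ← hP, ← hQ]
    rfl
  | monomial k c =>
    rw [aeval_monomial, eval_monomial, mul_smul]
    change c • ((funMul f ^ k) W) x = _
    congr 1
    induction k with
    | zero => simp
    | succ k ih =>
      rw [pow_succ', pow_succ', mul_smul, ← ih]
      rfl

theorem not_finiteDimensional_vectorFields [FiniteDimensional ℝ EN] [T2Space N] [Nontrivial EN]
    [Nonempty N] :
    ¬ FiniteDimensional ℝ Cₛ^∞⟮J; EN, (TangentSpace J : N → Type _)⟯ := by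
  intro hfin
  obtain ⟨q⟩ := ‹Nonempty N›
  obtain ⟨u, hu⟩ := exists_ne (0 : EN)
  refine hu (eq_zero_of_forall_dirD (J := J) (q := q) (v := u) fun f => ?_)
  set P := minpoly ℝ (funMul f)
  have hP : P ≠ 0 := minpoly.ne_zero (Algebra.IsIntegral.isIntegral _)
  -- `P` annihilates multiplication by `f`, so `P(f x)` kills the value at `x` of every field, and
  -- some field is nonzero at `x`.
  have hroot : ∀ x, f x ∈ P.rootSet ℝ := by
    intro x
    obtain ⟨W, hW⟩ := exists_field_eq J (q := x) u
    have h := aeval_funMul_apply f P W x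
    rw [minpoly.aeval, hW] at h
    rw [Polynomial.mem_rootSet]
    exact ⟨hP, by simpa using (smul_eq_zero.1 h.symm).resolve_right hu⟩
  -- The other roots form a finite, hence closed, set, which `f` avoids near `q` by continuity.
  have hconst : ∀ᶠ x in nhds q, f x = f q := by
    have hS : (P.rootSet ℝ \ {f q}).Finite := (P.rootSet_finite ℝ).subset Set.sdiff_subset
    filter_upwards [f.contMDiff.continuous.continuousAt.eventually
      (hS.isClosed.isOpen_compl.mem_nhds (by simp))] with x hx
    by_contra hne
    exact hx ⟨hroot x, hne⟩
  exact (dirD_congr hconst _).trans (dirD_const _ _)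

end Infinite

end KV

theorem mainTheorem2 (n : ℕ) (M : Type*) [TopologicalSpace M] [T2Space M]
    [ChartedSpace (EuclideanSpace ℝ (Fin n)) M] [IsManifold (𝓡 n) ∞ M] :
    (∀ X : KV.VectorFields n M, ∃! Y : KV.CoVectorFields n M, KV.IsCotangentLift X Y) ∧
    (∃ Φ : KV.VectorFields n M →ₗ[ℝ] KV.CotangentH1 n M,
      Function.Injective Φ ∧
      ∀ (X : KV.VectorFields n M) (Y : KV.CoVectorFields n M), KV.IsCotangentLift X Y →
        ∃ θ : KV.cycles1 ℝ (KV.CoAlgebra n M),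
          KV.IsLieDerivative Y (θ : KV.CoAlgebra n M →ₗ[ℝ] KV.CoAlgebra n M) ∧
          Φ X = Submodule.Quotient.mk θ) ∧
    (0 < n → Nonempty M → ¬ FiniteDimensional ℝ (KV.CotangentH1 n M)) := by
  refine ⟨KV.existsUnique_isCotangentLift, ⟨KV.lieClass n M, KV.lieClass_injective n M,
    fun X Y hY => ?_⟩, fun hn hM hfin => ?_⟩
  -- By uniqueness, `Y` may be replaced by the chosen lift from which the map was built.
  · obtain rfl := hY.eq
    exact ⟨KV.lieCycle n M X, KV.isLieDerivative_lieDer _, rfl⟩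
  · have : Nonempty (Fin n) := ⟨⟨0, hn⟩⟩
    exact KV.not_finiteDimensional_vectorFields (J := 𝓡 n) (N := M)
      (FiniteDimensional.of_injective (KV.lieClass n M) (KV.lieClass_injective n M))
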